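/- Let $n\ge 1$, let $b_1,\dots,b_n$ be a basis of $\mathbb{R}^n$, let $\Lambda=\mathbb{Z}b_1+\dots+\mathbb{Z}b_n$, and let $T^n=\mathbb{R}^n/\Lambda$ be the flat torus with the metric induced by the standard metric of $\mathbb{R}^n$. Let $\Lambda^*=\{l\in(\mathbb{R}^n)^*\mid l(v)\in\mathbb{Z}\text{ for all }v\in\Lambda\}$ be the dual lattice, with the Euclidean norm $|\cdot|$ on $(\mathbb{R}^n)^*$. Let $\alpha,\beta>0$ and $1\le p\le n$. Let $d$ be the exterior derivative, $\delta$ its formal adjoint with respect to the $L^2$-scalar product of forms, and let $$F=\alpha\, d\delta+\beta\,\delta d$$ act on the space $\Omega^p(T^n,\mathbb{C})$ of smooth complex-valued $p$-forms. For $z\in\mathbb{C}$ let $\mathrm{Eig}(F,z)=\{\omega\in\Omega^p(T^n,\mathbb{C})\mid F\omega=z\omega\}$. The spectrum of $F$ is the weighted set (function $\mathbb{C}\to\mathbb{N}_0$) $\mathrm{Spec}(F)(z)=\dim_{\mathbb{C}}\mathrm{Eig}(F,z)$. The weighted union $\Cup$ of weighted sets is the pointwise sum, and $\{x\}_m$ is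 the weighted set that takes the value $m$ at $x$ and $0$ elsewhere. For $l\in\Lambda^*$ and $\gamma\in\mathbb{R}$ put $\lambda^l_\gamma=4\pi^2\gamma|l|^2$ and $\chi_l([x])=e^{2\pi i\, l(x)}$, let $l^\sharp\in\mathbb{R}^n$ be the vector with $\langle l^\sharp,\cdot\rangle=l$, and put $$V_l^p=\chi_l\cdot\{\,l\wedge\eta\mid\eta\text{ a parallel complex }(p-1)\text{-form}\,\},\qquad W_l^p=\chi_l\cdot\{\,\omega\text{ a parallel complex }p\text{-form}\mid l^\sharp\lrcorner\,\omega=0\,\},$$ where parallel forms are the forms with constant coefficients. Then only finitely many $l\in\Lambda^*$ have any given norm, all spaces $\mathrm{Eig}(F,z)$ are finite-dimensional, $$\mathrm{Spec}(F)=\Bigl(\mathop{\Cup}_{l\in\Lambda^*}\{\lambda^l_\alpha\}_{\binom{n-1}{p-1}}\Bigr)\Cup\Bigl(\mathop{\Cup}_{l\in\Lambda^*}\{\lambda^l_\beta\}_{\binom{n-1}{p}}\Bigr)$$ (with $\binom{n-1}{n}=0$), and for every real $z$ the eigenspace of $F$ to $z$ on the real-valued smooth $p$-forms is finite-dimensional,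 its real dimension being also $\mathrm{Spec}(F)(z)$. Moreover, for every $k\in\Lambda^*$, $$\mathrm{Eig}(F,\lambda^k_\alpha)=\bigoplus_{l\in\Lambda^*,\ |l|=|k|}V_l^p\ \oplus\bigoplus_{l\in\Lambda^*,\ |l|=\sqrt{\alpha/\beta}\,|k|}W_l^p$$ and $$\mathrm{Eig}(F,\lambda^k_\beta)=\bigoplus_{l\in\Lambda^*,\ |l|=\sqrt{\beta/\alpha}\,|k|}V_l^p\ \oplus\bigoplus_{l\in\Lambda^*,\ |l|=|k|}W_l^p .$$ -/

import Mathlib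

open MeasureTheory

namespace FlatTorus

/-- Euclidean space `ℝⁿ`. -/
abbrev Space (n : ℕ) : Type := EuclideanSpace ℝ (Fin n)

/-- The standard orthonormal basis vectors of `ℝⁿ`. -/
noncomputable abbrev stdVec {n : ℕ} (i : Fin n) : Space n := EuclideanSpace.single i (1 : ℝ)

/-- The space of alternating `p`-forms on `ℝⁿ` with values in `𝕜`, where `𝕜` is `ℝ` or `ℂ`. -/
abbrev Alt (𝕜 : Type) [RCLike 𝕜] (n p : ℕ) : Type := Space n [⋀^Fin p]→L[ℝ] 𝕜

/-- The lattice `ℤ b₁ + ... + ℤ bₙ` induced by a basis `b` of `ℝⁿ`. -/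
abbrev lattice {n : ℕ} (b : Module.Basis (Fin n) ℝ (Space n)) : Submodule ℤ (Space n) :=
  Submodule.span ℤ (Set.range b)

/-- The torus `ℝⁿ / Λ`. -/
abbrev Torus {n : ℕ} (b : Module.Basis (Fin n) ℝ (Space n)) : Type := Space n ⧸ lattice b

/-- The canonical projection `ℝⁿ → ℝⁿ / Λ`. -/
abbrev proj {n : ℕ} (b : Module.Basis (Fin n) ℝ (Space n)) (x : Space n) : Torus b :=
  Submodule.Quotient.mk x

/-- The dual lattice `{l ∈ (ℝⁿ)* | l(v) ∈ ℤ for all v ∈ Λ}`. The norm of a linear form is the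
operator norm, i.e. the Euclidean norm on `(ℝⁿ)*`. -/
def dualLattice {n : ℕ} (b : Module.Basis (Fin n) ℝ (Space n)) :
    AddSubgroup (Space n →L[ℝ] ℝ) where
  carrier := {l | ∀ v ∈ lattice b, ∃ m : ℤ, l v = m}
  zero_mem' := fun _ _ => ⟨0, by simp⟩
  add_mem' := by
    intro l l' hl hl' v hv
    obtain ⟨m, hm⟩ := hl v hv
    obtain ⟨m', hm'⟩ := hl' v hv
    exact ⟨m + m', by simp [hm, hm']⟩
  neg_mem' := by
    intro l hl v hv
    obtain ⟨m, hm⟩ := hl v hv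
    exact ⟨-m, by simp [hm]⟩

/-- Smooth `𝕜`-valued differential `p`-forms on the torus `ℝⁿ / Λ`. Every tangent space of the torus
is identified with `ℝⁿ` through the differential of the projection, so that a `p`-form is a map from
the torus to the alternating `p`-forms on `ℝⁿ`; it is smooth if its pull-back to `ℝⁿ` is. -/
def smoothForms (𝕜 : Type) [RCLike 𝕜] {n : ℕ} (b : Module.Basis (Fin n) ℝ (Space n)) (p : ℕ) :
    Submodule 𝕜 (Torus b → Alt 𝕜 n p) where
  carrier := {ω | ContDiff ℝ (⊤ : ℕ∞) (fun x : Space n => ω (proj b x))}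
  zero_mem' := by
    rw [Set.mem_ofPred_eq]
    exact contDiff_const
  add_mem' := by
    intro ω η h h'
    rw [Set.mem_ofPred_eq] at *
    exact h.add h'
  smul_mem' := by
    intro c ω h
    rw [Set.mem_ofPred_eq] at *
    exact h.const_smul c

/-- The space `Ωᵖ` of smooth `𝕜`-valued differential `p`-forms on the torus. -/
def Form (𝕜 : Type) [RCLike 𝕜] {n : ℕ} (b : Module.Basis (Fin n) ℝ (Space n)) (p : ℕ) : Type :=
  smoothForms 𝕜 b p

noncomputable instance (𝕜 : Type) [RCLike 𝕜] {n : ℕ} (b : Module.Basis (Fin n) ℝ (Space n))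
    (p : ℕ) : AddCommGroup (Form 𝕜 b p) :=
  inferInstanceAs (AddCommGroup (smoothForms 𝕜 b p))

noncomputable instance (𝕜 : Type) [RCLike 𝕜] {n : ℕ} (b : Module.Basis (Fin n) ℝ (Space n))
    (p : ℕ) : Module 𝕜 (Form 𝕜 b p) :=
  inferInstanceAs (Module 𝕜 (smoothForms 𝕜 b p))

section Basic

variable {𝕜 : Type} [RCLike 𝕜] {n : ℕ} {b : Module.Basis (Fin n) ℝ (Space n)} {p : ℕ}

/-- The pull-back of a form along the projection `ℝⁿ → ℝⁿ / Λ`. -/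
def pull (ω : Form 𝕜 b p) (x : Space n) : Alt 𝕜 n p := ω.1 (proj b x)

theorem contDiff_pull (ω : Form 𝕜 b p) : ContDiff ℝ (⊤ : ℕ∞) (pull ω) := ω.2

theorem pull_add_mem (ω : Form 𝕜 b p) (x : Space n) {v : Space n} (hv : v ∈ lattice b) :
    pull ω (x + v) = pull ω x := by
  have : proj b (x + v) = proj b x := by
    rw [proj, proj, Submodule.Quotient.eq]
    simpa using hv
  rw [pull, pull, this]

@[ext]
theorem form_ext {ω η : Form 𝕜 b p} (h : ∀ x, pull ω x = pull η x) : ω = η := by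
  apply Subtype.ext
  funext t
  obtain ⟨x, rfl⟩ := Submodule.Quotient.mk_surjective _ t
  exact h x

theorem pull_add (ω η : Form 𝕜 b p) : pull (ω + η) = pull ω + pull η := rfl

theorem pull_smul (c : 𝕜) (ω : Form 𝕜 b p) : pull (c • ω) = c • pull ω := rfl

/-- The smooth form on the torus whose pull-back to `ℝⁿ` is a given periodic smooth form. -/
def ofPeriodic (f : Space n → Alt 𝕜 n p) (hf : ContDiff ℝ (⊤ : ℕ∞) f)
    (hper : ∀ x, ∀ v ∈ lattice b, f (x + v) = f x) : Form 𝕜 b p :=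
  ⟨fun t => Quotient.liftOn' t f (fun x y hxy => by
      have h := (Submodule.quotientRel_def _).1 hxy
      have := hper y _ h
      rwa [add_sub_cancel] at this), hf⟩

@[simp]
theorem pull_ofPeriodic (f : Space n → Alt 𝕜 n p) (hf : ContDiff ℝ (⊤ : ℕ∞) f)
    (hper : ∀ x, ∀ v ∈ lattice b, f (x + v) = f x) : pull (ofPeriodic f hf hper) = f := rfl

theorem fderiv_pull_add_mem (ω : Form 𝕜 b p) (x : Space n) {v : Space n}
    (hv : v ∈ lattice b) : fderiv ℝ (pull ω) (x + v) = fderiv ℝ (pull ω) x := by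
  rw [← fderiv_comp_add_right]
  congr 1
  funext y
  exact pull_add_mem ω y hv

theorem contDiff_fderiv_pull (ω : Form 𝕜 b p) :
    ContDiff ℝ (⊤ : ℕ∞) (fderiv ℝ (pull ω)) :=
  (contDiff_pull ω).fderiv_right (m := (⊤ : ℕ∞)) (by simp)

theorem contDiff_extDeriv_pull (ω : Form 𝕜 b p) :
    ContDiff ℝ (⊤ : ℕ∞) (extDeriv (pull ω)) := by
  have h := (ContinuousAlternatingMap.alternatizeUncurryFinCLM ℝ (Space n) 𝕜 (n := p)).contDiff
    (n := (⊤ : ℕ∞)) |>.comp (contDiff_fderiv_pull ω)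
  exact h

/-- The exterior derivative on the torus; in the identification of forms with their pull-backs it is
the exterior derivative on `ℝⁿ`. -/
noncomputable def extD : Form 𝕜 b p →ₗ[𝕜] Form 𝕜 b (p + 1) where
  toFun ω := ofPeriodic (extDeriv (pull ω))
    (contDiff_extDeriv_pull ω)
    (fun x v hv => by rw [extDeriv, extDeriv, fderiv_pull_add_mem ω x hv])
  map_add' ω η := by
    ext1 x
    exact extDeriv_add ((contDiff_pull ω).differentiable (by simp) x)
      ((contDiff_pull η).differentiable (by simp) x)
  map_smul' c ω := by
    ext1 x
    change extDeriv (c • pull ω) x = c • extDeriv (pull ω) x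
    rw [extDeriv, extDeriv, fderiv_const_smul_field, Pi.smul_apply,
      ContinuousAlternatingMap.alternatizeUncurryFin_smul]

theorem pull_extD (ω : Form 𝕜 b p) : pull (extD ω) = extDeriv (pull ω) := rfl

/-- The scalar product on alternating `p`-forms for which the forms
`e^{i₁} ∧ ... ∧ e^{i_p}`, `i₁ < ... < i_p`, are orthonormal. It is written as the sum over all
`p`-tuples of indices divided by `p!`. -/
noncomputable def altInner (φ ψ : Alt 𝕜 n p) : 𝕜 :=
  ((p.factorial : 𝕜))⁻¹ * ∑ I : Fin p → Fin n,
    inner 𝕜 (φ fun j => stdVec (I j)) (ψ fun j => stdVec (I j))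

/-- The `L²`-scalar product of forms on the torus with respect to the Riemannian volume. The integral
over the torus is the integral over the fundamental parallelotope
`{∑ tᵢ bᵢ | 0 ≤ tᵢ < 1}` of the lattice. -/
noncomputable def l2Inner (ω η : Form 𝕜 b p) : 𝕜 :=
  ∫ x in ZSpan.fundamentalDomain b, altInner (ω.1 (proj b x)) (η.1 (proj b x))

/-- `δ` is a formal adjoint of the exterior derivative on `p`-forms. -/
def IsFormalAdjoint (δ : Form 𝕜 b (p + 1) →ₗ[𝕜] Form 𝕜 b p) : Prop :=
  ∀ (ω : Form 𝕜 b p) (η : Form 𝕜 b (p + 1)), l2Inner (extD ω) η = l2Inner ω (δ η)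

theorem integrableOn_fundamentalDomain {F : Type} [NormedAddCommGroup F] [NormedSpace ℝ F]
    (f : Space n → F) (hf : Continuous f) (b : Module.Basis (Fin n) ℝ (Space n)) :
    IntegrableOn f (ZSpan.fundamentalDomain b) := by
  have hb := (ZSpan.fundamentalDomain_isBounded b).isCompact_closure
  exact (hf.continuousOn.integrableOn_compact hb).mono_set subset_closure

open scoped Pointwise in
theorem integral_translate (g : Space n → 𝕜) (b : Module.Basis (Fin n) ℝ (Space n))
    (hper : ∀ x, ∀ v ∈ lattice b, g (x + v) = g x) (w : Space n) :
    ∫ x in ZSpan.fundamentalDomain b, g (x + w) = ∫ x in ZSpan.fundamentalDomain b, g x := by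
  have : Countable (lattice b).toAddSubgroup := inferInstanceAs (Countable (lattice b))
  have h1 := ZSpan.isAddFundamentalDomain' b (volume : Measure (Space n))
  have h2 : IsAddFundamentalDomain (lattice b).toAddSubgroup (w +ᵥ ZSpan.fundamentalDomain b)
      (volume : Measure (Space n)) := h1.vadd_of_comm w
  have h3 := h1.setIntegral_eq h2 (f := g) (fun v x => by
    rw [AddSubgroup.vadd_def, vadd_eq_add, add_comm]; exact hper x v v.2)
  rw [h3]
  have hmp : MeasurePreserving (fun x : Space n => w + x) volume volume :=
    measurePreserving_add_left volume w
  have := hmp.setIntegral_image_emb (measurableEmbedding_addLeft w) g (ZSpan.fundamentalDomain b)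
  rw [show w +ᵥ ZSpan.fundamentalDomain b = (fun x => w + x) '' ZSpan.fundamentalDomain b from rfl,
    this]
  simp only [add_comm]

theorem bounded_of_periodic {F : Type} [NormedAddCommGroup F] (f : Space n → F)
    (hf : Continuous f) (b : Module.Basis (Fin n) ℝ (Space n))
    (hper : ∀ x, ∀ v ∈ lattice b, f (x + v) = f x) : ∃ C, ∀ x, ‖f x‖ ≤ C := by
  have := IsZLattice.isCompact_range_of_periodic (lattice b) f hf hper
  obtain ⟨C, hC⟩ := this.isBounded.exists_norm_le
  exact ⟨C, fun x => hC _ ⟨x, rfl⟩⟩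

theorem integral_fderiv_eq_zero (g : Space n → 𝕜) (hg : ContDiff ℝ (⊤ : ℕ∞) g)
    (b : Module.Basis (Fin n) ℝ (Space n))
    (hper : ∀ x, ∀ v ∈ lattice b, g (x + v) = g x) (w : Space n) :
    ∫ x in ZSpan.fundamentalDomain b, fderiv ℝ g x w = 0 := by
  have hc : Continuous (fun x => fderiv ℝ g x w) :=
    (hg.continuous_fderiv (by simp)).clm_apply continuous_const
  obtain ⟨C, hC⟩ := bounded_of_periodic (fun x => fderiv ℝ g x w) hc b (fun x v hv => by
    have : fderiv ℝ g (x + v) = fderiv ℝ g x := by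
      rw [← fderiv_comp_add_right]
      congr 1
      funext y
      exact hper y v hv
    simp only [this])
  have hline : ∀ (x : Space n) (t : ℝ), Continuous (fun x : Space n => x + t • w) :=
    fun x t => by fun_prop
  have key := hasDerivAt_integral_of_dominated_loc_of_deriv_le
    (μ := volume.restrict (ZSpan.fundamentalDomain b)) (s := Set.univ)
    (F := fun (t : ℝ) (x : Space n) => g (x + t • w))
    (F' := fun (t : ℝ) (x : Space n) => fderiv ℝ g (x + t • w) w) (x₀ := 0)
    (bound := fun _ => C) Filter.univ_mem
    (Filter.Eventually.of_forall fun t =>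
      (hg.continuous.comp (hline 0 t)).aestronglyMeasurable)
    (integrableOn_fundamentalDomain _ (hg.continuous.comp (hline 0 0)) b)
    ((hc.comp (hline 0 0)).aestronglyMeasurable)
    (Filter.Eventually.of_forall fun x t _ => hC _)
    (integrableOn_fundamentalDomain _ continuous_const b)
    (Filter.Eventually.of_forall fun x t _ => by
      have h1 : HasDerivAt (fun t : ℝ => x + t • w) w t := by
        simpa using ((hasDerivAt_id t).smul_const w).const_add x
      exact ((hg.differentiable (by simp) _).hasFDerivAt.comp_hasDerivAt t h1))
  have h2 := key.2
  simp only [integral_translate g b hper, zero_smul, add_zero] at h2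
  exact h2.unique (hasDerivAt_const _ _)

theorem pull_apply_contDiff (ω : Form 𝕜 b p) (v : Fin p → Space n) :
    ContDiff ℝ (⊤ : ℕ∞) (fun x => pull ω x v) :=
  (ContinuousAlternatingMap.apply ℝ (Space n) 𝕜 v).contDiff.comp (contDiff_pull ω)


theorem altInner_alternatizeUncurryFin (f : Space n →L[ℝ] Alt 𝕜 n p) (ψ : Alt 𝕜 n (p + 1)) :
    altInner (ContinuousAlternatingMap.alternatizeUncurryFin f) ψ =
      ∑ i : Fin n, altInner (f (stdVec i)) (ψ.curryLeft (stdVec i)) := by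
  have key : ∀ k : Fin (p + 1),
      ∑ J : Fin (p + 1) → Fin n,
        inner 𝕜 ((-1 : ℤ) ^ (k : ℕ) • f (stdVec (J k)) (k.removeNth fun j => stdVec (J j)))
          (ψ fun j => stdVec (J j)) =
      ∑ i : Fin n, ∑ I : Fin p → Fin n,
        inner 𝕜 (f (stdVec i) fun j => stdVec (I j))
          (ψ.curryLeft (stdVec i) fun j => stdVec (I j)) := by
    intro k
    rw [← (Fin.insertNthEquiv (fun _ => Fin n) k).sum_comp, Fintype.sum_prod_type]
    refine Finset.sum_congr rfl fun i _ => Finset.sum_congr rfl fun I _ => ?_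
    have h1 : (fun j => (stdVec ((Fin.insertNthEquiv (fun _ => Fin n) k (i, I)) j) : Space n)) =
        k.insertNth (stdVec i) (fun j => stdVec (I j)) := by
      funext j
      refine Fin.succAboveCases k ?_ (fun j => ?_) j <;> simp
    rw [h1, ContinuousAlternatingMap.map_insertNth, Fin.removeNth_insertNth,
      ContinuousAlternatingMap.curryLeft_apply_apply]
    have h2 : (Fin.insertNthEquiv (fun _ => Fin n) k (i, I)) k = i := by simp
    rw [h2]
    rcases neg_one_pow_eq_or ℤ (k : ℕ) with h | h <;> rw [h] <;> simp
  have hp : ((p + 1 : ℕ) : 𝕜) ≠ 0 := Nat.cast_ne_zero.2 (Nat.succ_ne_zero p)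
  have hp' : ((p.factorial : ℕ) : 𝕜) ≠ 0 := Nat.cast_ne_zero.2 (Nat.factorial_ne_zero p)
  simp only [altInner, ContinuousAlternatingMap.alternatizeUncurryFin_apply, sum_inner]
  rw [Finset.sum_comm, Finset.sum_congr rfl fun k _ => key k, ← Finset.mul_sum, Finset.sum_const,
    Finset.card_univ, Fintype.card_fin, nsmul_eq_mul, Nat.factorial_succ, Nat.cast_mul]
  field_simp

theorem altInner_neg_right (φ ψ : Alt 𝕜 n p) : altInner φ (-ψ) = -altInner φ ψ := by
  simp [altInner]

theorem altInner_sum_right {ι : Type} (s : Finset ι) (φ : Alt 𝕜 n p) (ψ : ι → Alt 𝕜 n p) :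
    altInner φ (∑ i ∈ s, ψ i) = ∑ i ∈ s, altInner φ (ψ i) := by
  simp only [altInner, ContinuousAlternatingMap.sum_apply, inner_sum]
  rw [Finset.sum_comm, Finset.mul_sum]

theorem contDiff_altInner {f g : Space n → Alt 𝕜 n p} (hf : ContDiff ℝ (⊤ : ℕ∞) f)
    (hg : ContDiff ℝ (⊤ : ℕ∞) g) : ContDiff ℝ (⊤ : ℕ∞) (fun x => altInner (f x) (g x)) := by
  refine contDiff_const.mul (ContDiff.sum fun I _ => ContDiff.inner 𝕜 ?_ ?_)
  · exact (ContinuousAlternatingMap.apply ℝ (Space n) 𝕜 _).contDiff.comp hf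
  · exact (ContinuousAlternatingMap.apply ℝ (Space n) 𝕜 _).contDiff.comp hg

theorem fderiv_altInner {f g : Space n → Alt 𝕜 n p} (hf : ContDiff ℝ (⊤ : ℕ∞) f)
    (hg : ContDiff ℝ (⊤ : ℕ∞) g) (x w : Space n) :
    fderiv ℝ (fun x => altInner (f x) (g x)) x w =
      altInner (fderiv ℝ f x w) (g x) + altInner (f x) (fderiv ℝ g x w) := by
  have happ : ∀ (h : Space n → Alt 𝕜 n p), ContDiff ℝ (⊤ : ℕ∞) h → ∀ v : Fin p → Space n,
      HasFDerivAt (fun x => h x v)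
        ((ContinuousAlternatingMap.apply ℝ (Space n) 𝕜 v).comp (fderiv ℝ h x)) x :=
    fun h hh v => (ContinuousAlternatingMap.apply ℝ (Space n) 𝕜 v).hasFDerivAt.comp x
      (hh.differentiable (by simp) x).hasFDerivAt
  have h1 := (HasFDerivAt.fun_sum (u := Finset.univ) fun (I : Fin p → Fin n) _ =>
    (happ f hf fun j => stdVec (I j)).inner 𝕜 (happ g hg fun j => stdVec (I j))).const_mul
      ((p.factorial : 𝕜)⁻¹)
  have h2 : HasFDerivAt (fun x => altInner (f x) (g x)) _ x := h1
  rw [h2.fderiv]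
  simp [altInner, Finset.sum_add_distrib, mul_add, add_comm]

/-- The operator `- ∑ᵢ eᵢ ⌟ ∂ᵢ`. -/
noncomputable def divFun (η : Form 𝕜 b (p + 1)) (x : Space n) : Alt 𝕜 n p :=
  -∑ i : Fin n, (fderiv ℝ (pull η) x (stdVec i)).curryLeft (stdVec i)

/-- Contraction of alternating forms with a fixed vector. -/
noncomputable def contractCLM (v : Space n) : Alt 𝕜 n (p + 1) →L[ℝ] Alt 𝕜 n p :=
  (ContinuousLinearMap.apply ℝ (Alt 𝕜 n p) v).comp
    (ContinuousAlternatingMap.curryLeftLI (𝕜 := ℝ) (E := Space n) (F := 𝕜)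
      (n := p)).toContinuousLinearMap

theorem contractCLM_apply (v : Space n) (φ : Alt 𝕜 n (p + 1)) :
    contractCLM v φ = φ.curryLeft v := rfl

theorem contDiff_curryLeft {f : Space n → Alt 𝕜 n (p + 1)} (hf : ContDiff ℝ (⊤ : ℕ∞) f)
    (v : Space n) : ContDiff ℝ (⊤ : ℕ∞) (fun x => (f x).curryLeft v) := by
  exact (contractCLM v).contDiff.comp hf

theorem contDiff_divFun (η : Form 𝕜 b (p + 1)) : ContDiff ℝ (⊤ : ℕ∞) (divFun η) :=
  (ContDiff.sum fun _ _ => contDiff_curryLeft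
    ((contDiff_fderiv_pull η).clm_apply contDiff_const) _).neg

/-- The operator `- ∑ᵢ eᵢ ⌟ ∂ᵢ` on forms on the torus. -/
noncomputable def divLin : Form 𝕜 b (p + 1) →ₗ[𝕜] Form 𝕜 b p where
  toFun η := ofPeriodic (divFun η) (contDiff_divFun η)
    (fun x v hv => by rw [divFun, divFun, fderiv_pull_add_mem η x hv])
  map_add' η θ := by
    ext1 x
    change divFun (η + θ) x = divFun η x + divFun θ x
    have h : fderiv ℝ (pull (η + θ)) x = fderiv ℝ (pull η) x + fderiv ℝ (pull θ) x := by
      rw [pull_add]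
      exact fderiv_add ((contDiff_pull η).differentiable (by simp) x)
        ((contDiff_pull θ).differentiable (by simp) x)
    simp only [divFun, h, ← contractCLM_apply, add_apply, map_add,
      Finset.sum_add_distrib, neg_add]
  map_smul' c η := by
    ext1 x
    change divFun (c • η) x = c • divFun η x
    have : fderiv ℝ (pull (c • η)) x = c • fderiv ℝ (pull η) x := by
      exact congrFun (fderiv_const_smul_field (𝕜 := ℝ) c (f := pull η)) x
    simp only [divFun, this, smul_neg, Finset.smul_sum]
    rfl

theorem pull_divLin (η : Form 𝕜 b (p + 1)) : pull (divLin η) = divFun η := rfl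

theorem isFormalAdjoint_divLin : IsFormalAdjoint (divLin : Form 𝕜 b (p + 1) →ₗ[𝕜] Form 𝕜 b p) := by
  intro ω η
  have hg : ∀ i : Fin n, ContDiff ℝ (⊤ : ℕ∞)
      (fun x => altInner (pull ω x) ((pull η x).curryLeft (stdVec i))) := fun i =>
    contDiff_altInner (contDiff_pull ω) (contDiff_curryLeft (contDiff_pull η) _)
  have hpt : ∀ x : Space n, altInner (pull (extD ω) x) (pull η x) =
      altInner (pull ω x) (pull (divLin η) x) + ∑ i : Fin n,
        fderiv ℝ (fun x => altInner (pull ω x) ((pull η x).curryLeft (stdVec i))) x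
          (stdVec i) := by
    intro x
    rw [pull_extD, pull_divLin, extDeriv, altInner_alternatizeUncurryFin, divFun,
      altInner_neg_right, altInner_sum_right, neg_add_eq_sub, ← Finset.sum_sub_distrib]
    refine Finset.sum_congr rfl fun i _ => ?_
    rw [fderiv_altInner (contDiff_pull ω) (contDiff_curryLeft (contDiff_pull η) _)]
    have : fderiv ℝ (fun x => (pull η x).curryLeft (stdVec i)) x (stdVec i) =
        (fderiv ℝ (pull η) x (stdVec i)).curryLeft (stdVec i) := by
      have h := (contractCLM (stdVec i : Space n)).hasFDerivAt.comp x
        ((contDiff_pull η).differentiable (by simp) x).hasFDerivAt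
      have h' : HasFDerivAt (fun x => (pull η x).curryLeft (stdVec i)) _ x := h
      rw [h'.fderiv]
      rfl
    rw [this, add_sub_cancel_right]
  have hint : ∀ i : Fin n, IntegrableOn (fun x => fderiv ℝ
      (fun x => altInner (pull ω x) ((pull η x).curryLeft (stdVec i))) x (stdVec i))
      (ZSpan.fundamentalDomain b) := fun i =>
    integrableOn_fundamentalDomain _
      (((hg i).continuous_fderiv (by simp)).clm_apply continuous_const) b
  have hper : ∀ (i : Fin n) (x : Space n), ∀ v ∈ lattice b,
      altInner (pull ω (x + v)) ((pull η (x + v)).curryLeft (stdVec i)) =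
        altInner (pull ω x) ((pull η x).curryLeft (stdVec i)) := by
    intro i x v hv
    rw [pull_add_mem ω x hv, pull_add_mem η x hv]
  change ∫ x in ZSpan.fundamentalDomain b, altInner (pull (extD ω) x) (pull η x) =
    ∫ x in ZSpan.fundamentalDomain b, altInner (pull ω x) (pull (divLin η) x)
  simp only [hpt]
  rw [integral_add, integral_finsetSum _ fun i _ => hint i,
    Finset.sum_eq_zero fun i _ => integral_fderiv_eq_zero _ (hg i) b (hper i) _, add_zero]
  · exact integrableOn_fundamentalDomain _
      (contDiff_altInner (contDiff_pull ω) (contDiff_pull (divLin η))).continuous b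
  · exact integrable_finsetSum _ fun i _ => hint i

theorem altInner_self (φ : Alt 𝕜 n p) : altInner φ φ =
    (((p.factorial : ℝ)⁻¹ * ∑ I : Fin p → Fin n, ‖φ fun j => stdVec (I j)‖ ^ 2 : ℝ) : 𝕜) := by
  simp only [altInner, inner_self_eq_norm_sq_to_K]
  push_cast
  rfl

theorem eq_zero_of_altInner_self_re {φ : Alt 𝕜 n p}
    (h : RCLike.re (altInner φ φ) = 0) : φ = 0 := by
  rw [altInner_self, RCLike.ofReal_re] at h
  have hp : ((p.factorial : ℝ)⁻¹) ≠ 0 :=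
    inv_ne_zero (Nat.cast_ne_zero.2 (Nat.factorial_ne_zero p))
  have h1 := (mul_eq_zero.1 h).resolve_left hp
  rw [Finset.sum_eq_zero_iff_of_nonneg fun _ _ => by positivity] at h1
  apply ContinuousAlternatingMap.toAlternatingMap_injective
  refine (EuclideanSpace.basisFun (Fin n) ℝ).toBasis.ext_alternating fun I _ => ?_
  have h2 := h1 I (Finset.mem_univ I)
  simpa using h2

open scoped Pointwise in
theorem form_eq_zero_of_l2Inner_self {ω : Form 𝕜 b p} (h : l2Inner ω ω = 0) : ω = 0 := by
  have hcont : Continuous fun x => altInner (pull ω x) (pull ω x) :=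
    (contDiff_altInner (contDiff_pull ω) (contDiff_pull ω)).continuous
  have hre : Continuous fun x => RCLike.re (altInner (pull ω x) (pull ω x)) :=
    RCLike.continuous_re.comp hcont
  have hint := integrableOn_fundamentalDomain _ hcont b
  have h0 : ∫ x in ZSpan.fundamentalDomain b, RCLike.re (altInner (pull ω x) (pull ω x)) = 0 := by
    have h1 : RCLike.re (l2Inner ω ω) = 0 := by rw [h]; simp
    rw [← h1]
    exact integral_re hint
  have hnonneg : ∀ x, 0 ≤ RCLike.re (altInner (pull ω x) (pull ω x)) := by
    intro x
    rw [altInner_self, RCLike.ofReal_re]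
    positivity
  rw [setIntegral_eq_zero_iff_of_nonneg_ae (Filter.Eventually.of_forall hnonneg)
    (integrableOn_fundamentalDomain _ hre b)] at h0
  have : Countable (lattice b).toAddSubgroup := inferInstanceAs (Countable (lattice b))
  have hD := ZSpan.isAddFundamentalDomain' b (volume : Measure (Space n))
  have hz : volume {x | pull ω x ≠ 0} = 0 := by
    refine hD.measure_zero_of_invariant _ (fun v => ?_) ?_
    · ext x
      have hv : -(v : Space n) ∈ lattice b := (lattice b).neg_mem v.2
      have hmem : -v +ᵥ x = x + -(v : Space n) := by
        rw [AddSubgroup.vadd_def, vadd_eq_add, add_comm]; rfl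
      rw [Set.mem_vadd_set_iff_neg_vadd_mem, Set.mem_ofPred_eq, Set.mem_ofPred_eq, hmem,
        pull_add_mem ω x hv]
    · have h1 : ∀ᵐ x ∂volume.restrict (ZSpan.fundamentalDomain b), pull ω x = 0 := by
        filter_upwards [h0] with x hx
        exact eq_zero_of_altInner_self_re hx
      have h2 := (ae_iff.1 h1)
      rwa [Measure.restrict_apply₀' hD.nullMeasurableSet] at h2
  have hae : pull ω =ᵐ[volume] fun _ => 0 := hz
  have := (Continuous.ae_eq_iff_eq volume (contDiff_pull ω).continuous continuous_const).1 hae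
  ext1 x
  exact congrFun this x

theorem l2Inner_sub_right (ω η θ : Form 𝕜 b p) :
    l2Inner ω (η - θ) = l2Inner ω η - l2Inner ω θ := by
  have hint : ∀ η : Form 𝕜 b p, IntegrableOn (fun x => altInner (pull ω x) (pull η x))
      (ZSpan.fundamentalDomain b) := fun η => integrableOn_fundamentalDomain _
    (contDiff_altInner (contDiff_pull ω) (contDiff_pull η)).continuous b
  refine Eq.trans ?_ (integral_sub (hint η) (hint θ))
  refine integral_congr_ae (Filter.Eventually.of_forall fun x => ?_)
  change altInner (pull ω x) (pull η x - pull θ x) =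
    altInner (pull ω x) (pull η x) - altInner (pull ω x) (pull θ x)
  simp only [altInner, ContinuousAlternatingMap.sub_apply, inner_sub_right,
    Finset.sum_sub_distrib, mul_sub]

/-- The formal adjoint of the exterior derivative exists and is unique. -/
theorem existsUnique_formalAdjoint :
    ∃! δ : Form 𝕜 b (p + 1) →ₗ[𝕜] Form 𝕜 b p, IsFormalAdjoint δ := by
  refine ⟨divLin, isFormalAdjoint_divLin, fun δ hδ => ?_⟩
  refine LinearMap.ext fun η => ?_
  rw [← sub_eq_zero]
  apply form_eq_zero_of_l2Inner_self
  rw [l2Inner_sub_right, ← hδ, ← isFormalAdjoint_divLin, sub_self]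

/-- The codifferential `δ`: the formal adjoint of the exterior derivative. -/
noncomputable def codiff : Form 𝕜 b (p + 1) →ₗ[𝕜] Form 𝕜 b p :=
  Classical.choose (existsUnique_formalAdjoint (𝕜 := 𝕜) (b := b) (p := p)).exists

theorem isFormalAdjoint_codiff :
    IsFormalAdjoint (codiff : Form 𝕜 b (p + 1) →ₗ[𝕜] Form 𝕜 b p) :=
  Classical.choose_spec (existsUnique_formalAdjoint (𝕜 := 𝕜) (b := b) (p := p)).exists

theorem codiff_eq_divLin : (codiff : Form 𝕜 b (p + 1) →ₗ[𝕜] Form 𝕜 b p) = divLin :=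
  existsUnique_formalAdjoint.unique isFormalAdjoint_codiff isFormalAdjoint_divLin

end Basic

/-- The generalized Hodge-Laplace operator `α d δ + β δ d` on `p`-forms (on functions `δ = 0`). -/
noncomputable def genHodge (𝕜 : Type) [RCLike 𝕜] {n : ℕ} (b : Module.Basis (Fin n) ℝ (Space n))
    (α β : ℝ) : (p : ℕ) → Module.End 𝕜 (Form 𝕜 b p)
  | 0 => (β : 𝕜) • (codiff ∘ₗ extD)
  | _ + 1 => (α : 𝕜) • (extD ∘ₗ codiff) + (β : 𝕜) • (codiff ∘ₗ extD)

/-- The eigenspace of `α d δ + β δ d` on smooth `𝕜`-valued `p`-forms to `z`. -/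
noncomputable abbrev Eig (𝕜 : Type) [RCLike 𝕜] {n : ℕ} (b : Module.Basis (Fin n) ℝ (Space n))
    (α β : ℝ) (p : ℕ) (z : 𝕜) : Submodule 𝕜 (Form 𝕜 b p) :=
  Module.End.eigenspace (R := 𝕜) (M := Form 𝕜 b p) (genHodge 𝕜 b α β p) z

/-- A weighted set: a function which assigns to each complex number its multiplicity. The weighted
union of two weighted sets is the sum of the two functions. -/
abbrev WeightedSet : Type := ℂ → ℕ

/-- The weighted set which consists of `x` with multiplicity `m`. -/
noncomputable def weightedSingle (x : ℂ) (m : ℕ) : WeightedSet := Pi.single x m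

/-- The weighted union of a family of weighted sets (every point being in the support of only
finitely many members of the family). -/
noncomputable def weightedUnion {ι : Type} (W : ι → WeightedSet) : WeightedSet :=
  fun z => ∑ᶠ i, W i z

/-- The spectrum of `α d δ + β δ d` on `p`-forms as a weighted set. -/
noncomputable def spec {n : ℕ} (b : Module.Basis (Fin n) ℝ (Space n)) (α β : ℝ) (p : ℕ) :
    WeightedSet :=
  fun z => Module.finrank ℂ (Eig ℂ b α β p z)

section Fourier

variable {n : ℕ} {b : Module.Basis (Fin n) ℝ (Space n)}

/-- The number `4 π² γ |l|²`. -/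
noncomputable def lam (γ : ℝ) (l : dualLattice b) : ℝ := 4 * Real.pi ^ 2 * γ * ‖l.1‖ ^ 2

/-- The character `[x] ↦ exp (2 π i l(x))` of the torus. -/
noncomputable def chi (l : dualLattice b) (t : Torus b) : ℂ :=
  Quotient.liftOn' t (fun x => Complex.exp (2 * Real.pi * Complex.I * (l.1 x : ℂ))) (by
    intro x y hxy
    have h := (Submodule.quotientRel_def _).1 hxy
    obtain ⟨m, hm⟩ := l.2 _ h
    rw [map_sub, sub_eq_iff_eq_add] at hm
    have h1 : (2 * Real.pi * Complex.I * (l.1 x : ℂ)) =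
        2 * Real.pi * Complex.I * (l.1 y : ℂ) + m * (2 * Real.pi * Complex.I) := by
      rw [hm]
      push_cast
      ring
    simp only [h1]
    exact Complex.exp_periodic.int_mul m _)

theorem chi_proj (l : dualLattice b) (x : Space n) :
    chi l (proj b x) = Complex.exp (2 * Real.pi * Complex.I * (l.1 x : ℂ)) := rfl

theorem contDiff_chi (l : dualLattice b) :
    ContDiff ℝ (⊤ : ℕ∞) (fun x : Space n => chi l (proj b x)) := by
  simp only [chi_proj]
  exact (contDiff_const.mul (Complex.ofRealCLM.contDiff.comp l.1.contDiff)).cexp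

/-- The map `φ ↦ χ_l φ` on parallel (i.e. constant-coefficient) complex `p`-forms `φ`. -/
noncomputable def chiMul (l : dualLattice b) (p : ℕ) : Alt ℂ n p →ₗ[ℂ] Form ℂ b p where
  toFun φ := ⟨fun t => chi l t • φ, (contDiff_chi l).smul contDiff_const⟩
  map_add' φ ψ := by
    ext1 x
    exact smul_add (chi l (proj b x)) φ ψ
  map_smul' c φ := by
    ext1 x
    exact smul_comm (chi l (proj b x)) c φ

/-- The map `η ↦ l ∧ η`. -/
noncomputable def wedge (l : Space n →L[ℝ] ℝ) (p : ℕ) : Alt ℂ n p →ₗ[ℂ] Alt ℂ n (p + 1) where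
  toFun η := ContinuousAlternatingMap.alternatizeUncurryFin (l.smulRight η)
  map_add' η θ := by
    ext v
    simp [ContinuousAlternatingMap.alternatizeUncurryFin_apply, Finset.sum_add_distrib]
  map_smul' c η := by
    rw [← ContinuousAlternatingMap.alternatizeUncurryFin_smul]
    congr 1
    ext v : 1
    exact smul_comm (l v) c η

/-- The contraction `φ ↦ v ⌟ φ = φ(v, ·, ..., ·)`. -/
noncomputable def contract (v : Space n) (p : ℕ) : Alt ℂ n (p + 1) →ₗ[ℂ] Alt ℂ n p where
  toFun φ := φ.curryLeft v
  map_add' _ _ := rfl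
  map_smul' _ _ := rfl

/-- The vector `l^♯` with `⟨l^♯, ·⟩ = l`. -/
noncomputable def sharp (l : Space n →L[ℝ] ℝ) : Space n := (InnerProductSpace.toDual ℝ (Space n)).symm l

/-- The space `χ_l {l ∧ η | η a parallel (p - 1)-form}` of `p`-forms. -/
noncomputable def V (l : dualLattice b) : (p : ℕ) → Submodule ℂ (Form ℂ b p)
  | 0 => ⊥
  | p + 1 => (LinearMap.range (wedge l.1 p)).map (chiMul l (p + 1))

/-- The space `χ_l {φ | φ a parallel p-form with l^♯ ⌟ φ = 0}` of `p`-forms. -/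
noncomputable def W (l : dualLattice b) : (p : ℕ) → Submodule ℂ (Form ℂ b p)
  | 0 => LinearMap.range (chiMul l 0)
  | p + 1 => (LinearMap.ker (contract (sharp l.1) p)).map (chiMul l (p + 1))

/-- The submodule `U` is the (internal, algebraic) direct sum of the family `A`. -/
def IsDirectSum {M ι : Type} [AddCommGroup M] [Module ℂ M] (U : Submodule ℂ M)
    (A : ι → Submodule ℂ M) : Prop :=
  iSupIndep A ∧ U = ⨆ i, A i

/-- The family which consists of all `V l` with `|l| = r` and all `W l` with `|l| = s`. -/
noncomputable def eigFamily (b : Module.Basis (Fin n) ℝ (Space n)) (p : ℕ) (r s : ℝ) :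
    {l : dualLattice b // ‖l.1‖ = r} ⊕ {l : dualLattice b // ‖l.1‖ = s} →
      Submodule ℂ (Form ℂ b p) :=
  Sum.elim (fun l => V l.1 p) (fun l => W l.1 p)

end Fourier

end FlatTorus

/-!
Taking Fourier coefficients with respect to the characters `χ_l` turns `d` into `2πi l ∧ ·` and
`δ` into `-2πi l^♯ ⌟ ·`, hence `α d δ + β δ d` into its symbol, an endomorphism of the parallel
forms. By Cartan's formula `l^♯ ⌟ (l ∧ η) + l ∧ (l^♯ ⌟ η) = |l|² η`, for each `l` the parallel
forms are the direct sum of the range of `l ∧ ·` and the kernel of `l^♯ ⌟ ·`, on which the symbol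
is multiplication by `λ^l_α` and `λ^l_β`. Since trigonometric polynomials are dense in the
continuous functions on the torus, a form is determined by its Fourier coefficients, and since
only finitely many of these can be nonzero for an eigenform, the eigenspaces are finite direct
sums of eigenspaces of symbols. For a real eigenvalue, a complex eigenform is a pair of real
eigenforms, which transfers the multiplicities to real-valued forms.
-/

namespace FlatTorus

section AlternatingMaps

open Module

theorem continuous_of_multilinearMap {𝕜 E F ι : Type*} [NontriviallyNormedField 𝕜] [CompleteSpace 𝕜]
    [NormedAddCommGroup E] [NormedSpace 𝕜 E] [FiniteDimensional 𝕜 E] [AddCommGroup F] [Module 𝕜 F]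
    [TopologicalSpace F] [ContinuousAdd F] [ContinuousSMul 𝕜 F] [Finite ι]
    (f : MultilinearMap 𝕜 (fun _ : ι => E) F) : Continuous f := by
  classical
  have := Fintype.ofFinite ι
  let e := finBasis 𝕜 E
  have expand : (f : (ι → E) → F) =
      fun v => ∑ I : ι → Fin (finrank 𝕜 E), (∏ j, e.coord (I j) (v j)) • f fun j => e (I j) := by
    funext v
    conv_lhs => rw [← funext fun j => e.sum_repr (v j), f.map_sum]
    exact Finset.sum_congr rfl fun I _ => f.map_smul_univ _ _
  have hcoord (i) : Continuous (e.coord i) := (e.coord i).continuous_of_finiteDimensional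
  rw [expand]
  fun_prop

variable (E : Type*) [NormedAddCommGroup E] [NormedSpace ℝ E] [FiniteDimensional ℝ E] (p : ℕ)

/-- Complex-valued continuous alternating maps on a finite-dimensional real space, as linear maps on
the exterior power; continuity is automatic. -/
noncomputable def exteriorPowerEquiv :
    E [⋀^Fin p]→L[ℝ] ℂ ≃ₗ[ℝ] (⋀[ℝ]^p E →ₗ[ℝ] ℂ) :=
  { toFun := fun φ => φ.toAlternatingMap
    map_add' := fun _ _ => rfl
    map_smul' := fun _ _ => rfl
    invFun := fun f => { f with cont := continuous_of_multilinearMap f.toMultilinearMap }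
    left_inv := fun _ => rfl
    right_inv := fun _ => rfl : E [⋀^Fin p]→L[ℝ] ℂ ≃ₗ[ℝ] E [⋀^Fin p]→ₗ[ℝ] ℂ } ≪≫ₗ
  exteriorPower.alternatingMapLinearEquiv

instance : FiniteDimensional ℝ (E [⋀^Fin p]→L[ℝ] ℂ) :=
  (exteriorPowerEquiv E p).symm.finiteDimensional

instance : FiniteDimensional ℂ (E [⋀^Fin p]→L[ℝ] ℂ) := FiniteDimensional.right ℝ ℂ _

theorem finrank_continuousAlternatingMap :
    finrank ℂ (E [⋀^Fin p]→L[ℝ] ℂ) = (finrank ℝ E).choose p := by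
  have h := (exteriorPowerEquiv E p).finrank_eq
  rw [finrank_linearMap, exteriorPower.finrank_eq, Complex.finrank_real_complex,
    finrank_real_of_complex] at h
  omega

end AlternatingMaps

section Wedge

open Module
open ContinuousAlternatingMap (alternatizeUncurryFin alternatizeUncurryFin_apply
  alternatizeUncurryFin_alternatizeUncurryFinCLM_comp_of_symmetric)

variable {n p : ℕ}

theorem finrank_alt : finrank ℂ (Alt ℂ n p) = n.choose p := by
  rw [finrank_continuousAlternatingMap, finrank_euclideanSpace_fin]

theorem wedge_apply (l : Space n →L[ℝ] ℝ) (η : Alt ℂ n p) (v : Fin (p + 1) → Space n) :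
    wedge l p η v = ∑ i : Fin (p + 1), (-1) ^ (i : ℕ) • (l (v i) • η (i.removeNth v)) :=
  alternatizeUncurryFin_apply _ _

theorem contract_apply (w : Space n) (φ : Alt ℂ n (p + 1)) (v : Fin p → Space n) :
    contract w p φ v = φ (Matrix.vecCons w v) := rfl

/-- Cartan's formula. -/
theorem contract_wedge_add_wedge_contract (l : Space n →L[ℝ] ℝ) (w : Space n)
    (η : Alt ℂ n (p + 1)) :
    contract w (p + 1) (wedge l (p + 1) η) + wedge l p (contract w p η) = l w • η := by
  ext v
  rw [ContinuousAlternatingMap.add_apply, contract_apply, wedge_apply, Fin.sum_univ_succ,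
    wedge_apply, add_assoc, ← Finset.sum_add_distrib, Finset.sum_eq_zero]
  · simp [Matrix.vecCons]
  · intro i _
    have remove_succ : (i.succ.removeNth (Matrix.vecCons w v) : Fin (p + 1) → Space n) =
        Matrix.vecCons w (i.removeNth v) := by
      funext j
      refine Fin.cases ?_ (fun j => ?_) j <;> simp [Fin.removeNth]
    rw [remove_succ, contract_apply]
    simp [pow_succ]

theorem contract_wedge_of_zero_form (l : Space n →L[ℝ] ℝ) (w : Space n) (η : Alt ℂ n 0) :
    contract w 0 (wedge l 0 η) = l w • η := by
  ext v
  rw [contract_apply, wedge_apply]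
  simp [Subsingleton.elim _ v]

theorem wedge_wedge (l : Space n →L[ℝ] ℝ) (η : Alt ℂ n p) :
    wedge l (p + 1) (wedge l p η) = 0 := by
  rw [← alternatizeUncurryFin_alternatizeUncurryFinCLM_comp_of_symmetric
    (f := l.smulRight (l.smulRight η)) fun x y => by simp [smul_smul, mul_comm]]
  change alternatizeUncurryFin _ = _
  congr 1
  ext x : 1
  simp [wedge]

theorem contract_contract (w : Space n) (φ : Alt ℂ n (p + 2)) :
    contract w p (contract w (p + 1) φ) = 0 := by
  ext v
  rw [contract_apply, contract_apply]
  exact φ.map_eq_zero_of_eq _ (i := 0) (j := 1) (by simp) (by simp)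

theorem wedge_zero : wedge (0 : Space n →L[ℝ] ℝ) p = 0 := by
  ext η v
  rw [wedge_apply]
  simp

theorem contract_zero : contract (0 : Space n) p = 0 := by
  ext φ v
  rw [contract_apply]
  exact φ.map_coord_zero 0 (by simp)

theorem sharp_zero : sharp (0 : Space n →L[ℝ] ℝ) = 0 :=
  map_zero _

theorem apply_sharp (l : Space n →L[ℝ] ℝ) : l (sharp l) = ‖l‖ ^ 2 := by
  rw [sharp, ← (InnerProductSpace.toDual ℝ (Space n)).symm.norm_map l,
    ← real_inner_self_eq_norm_sq, InnerProductSpace.toDual_symm_apply]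

theorem contract_sharp_wedge_add (l : Space n →L[ℝ] ℝ) (η : Alt ℂ n (p + 1)) :
    contract (sharp l) (p + 1) (wedge l (p + 1) η) + wedge l p (contract (sharp l) p η) =
      (‖l‖ ^ 2 : ℂ) • η := by
  rw [contract_wedge_add_wedge_contract, apply_sharp, ← Complex.ofReal_pow]
  exact (Complex.coe_smul (‖l‖ ^ 2) η).symm

variable {l : Space n →L[ℝ] ℝ}

theorem ofReal_norm_sq_ne_zero (hl : l ≠ 0) : (‖l‖ ^ 2 : ℂ) ≠ 0 :=
  pow_ne_zero _ (Complex.ofReal_ne_zero.2 (norm_ne_zero_iff.2 hl))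

theorem range_wedge_eq_ker_wedge (hl : l ≠ 0) :
    LinearMap.range (wedge l p) = LinearMap.ker (wedge l (p + 1)) := by
  apply le_antisymm
  · rintro _ ⟨η, rfl⟩
    exact wedge_wedge l η
  · intro η hη
    have h := contract_sharp_wedge_add l η
    rw [LinearMap.mem_ker.1 hη, map_zero, zero_add] at h
    refine ⟨(‖l‖ ^ 2 : ℂ)⁻¹ • contract (sharp l) p η, ?_⟩
    rw [map_smul, h, inv_smul_smul₀ (ofReal_norm_sq_ne_zero hl) η]

theorem ker_wedge_of_zero_form (hl : l ≠ 0) : LinearMap.ker (wedge l 0) = ⊥ := by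
  refine (Submodule.eq_bot_iff _).2 fun η hη => ?_
  have h := contract_wedge_of_zero_form l (sharp l) η
  rw [LinearMap.mem_ker.1 hη, map_zero, apply_sharp] at h
  exact (smul_eq_zero.1 h.symm).resolve_left (pow_ne_zero _ (norm_ne_zero_iff.2 hl))

theorem finrank_range_wedge (hn : 1 ≤ n) (hl : l ≠ 0) :
    finrank ℂ (LinearMap.range (wedge l p)) = (n - 1).choose p := by
  obtain ⟨m, rfl⟩ := Nat.exists_eq_add_of_le' hn
  induction p with
  | zero =>
    have h := LinearMap.finrank_range_add_finrank_ker (wedge l 0)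
    rw [ker_wedge_of_zero_form hl, finrank_bot, finrank_alt] at h
    simpa using h
  | succ p ih =>
    have h := LinearMap.finrank_range_add_finrank_ker (wedge l (p + 1))
    rw [← range_wedge_eq_ker_wedge hl, ih, finrank_alt, Nat.choose_succ_succ'] at h
    simp only [Nat.add_sub_cancel] at h ⊢
    omega

theorem isCompl_range_wedge_ker_contract (l : Space n →L[ℝ] ℝ) :
    IsCompl (LinearMap.range (wedge l p)) (LinearMap.ker (contract (sharp l) p)) := by
  rcases eq_or_ne l 0 with rfl | hl
  · rw [wedge_zero, sharp_zero, contract_zero, LinearMap.range_zero, LinearMap.ker_zero]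
    exact isCompl_bot_top
  have hl2 := ofReal_norm_sq_ne_zero hl
  constructor
  · rw [Submodule.disjoint_def, range_wedge_eq_ker_wedge hl]
    intro η h1 h2
    have h := contract_sharp_wedge_add l η
    rw [LinearMap.mem_ker.1 h1, LinearMap.mem_ker.1 h2, map_zero, map_zero, add_zero] at h
    exact (smul_eq_zero.1 h.symm).resolve_left hl2
  · rw [codisjoint_iff, Submodule.eq_top_iff']
    intro η
    rw [← inv_smul_smul₀ hl2 η, ← contract_sharp_wedge_add l η, add_comm (contract _ _ _)]
    exact Submodule.smul_mem _ _ (Submodule.add_mem_sup ⟨_, rfl⟩ (contract_contract _ _))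

theorem finrank_ker_contract_sharp (hn : 1 ≤ n) (hl : l ≠ 0) :
    finrank ℂ (LinearMap.ker (contract (sharp l) p)) = (n - 1).choose (p + 1) := by
  have h := Submodule.finrank_add_eq_of_isCompl (isCompl_range_wedge_ker_contract (p := p) l)
  obtain ⟨m, rfl⟩ := Nat.exists_eq_add_of_le' hn
  rw [finrank_range_wedge hn hl, finrank_alt, Nat.choose_succ_succ'] at h
  simp only [Nat.add_sub_cancel] at h ⊢
  omega

end Wedge

section Symbol

open Module

theorem eigenspace_eq_of_isCompl {K M : Type*} [Field K] [AddCommGroup M] [Module K M]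
    {T : End K M} {A B : Submodule K M} (h : IsCompl A B) {a b : K}
    (hA : ∀ x ∈ A, T x = a • x) (hB : ∀ x ∈ B, T x = b • x) (z : K) :
    End.eigenspace T z = (⨆ _ : a = z, A) ⊔ ⨆ _ : b = z, B := by
  apply le_antisymm
  · intro x hx
    obtain ⟨y, hy, w, hw, rfl⟩ := Submodule.mem_sup.1 (h.sup_eq_top ▸ Submodule.mem_top (x := x))
    have hsum : (a - z) • y + (b - z) • w = 0 := by
      rw [End.mem_eigenspace_iff, map_add, hA y hy, hB w hw, smul_add] at hx
      rw [sub_smul, sub_smul, sub_add_sub_comm, hx, sub_self]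
    have hy0 : (a - z) • y = 0 := by
      refine Submodule.disjoint_def.1 h.disjoint _ (A.smul_mem _ hy) ?_
      rw [eq_neg_of_add_eq_zero_left hsum]
      exact B.neg_mem (B.smul_mem _ hw)
    rw [hy0, zero_add] at hsum
    refine Submodule.add_mem_sup ?_ ?_
    · rcases smul_eq_zero.1 hy0 with h | rfl
      · exact Submodule.mem_iSup_of_mem (sub_eq_zero.1 h) hy
      · exact zero_mem _
    · rcases smul_eq_zero.1 hsum with h | rfl
      · exact Submodule.mem_iSup_of_mem (sub_eq_zero.1 h) hw
      · exact zero_mem _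
  · refine sup_le (iSup_le ?_) (iSup_le ?_)
    · rintro rfl x hx
      exact End.mem_eigenspace_iff.2 (hA x hx)
    · rintro rfl x hx
      exact End.mem_eigenspace_iff.2 (hB x hx)

theorem finrank_iSup_prop {K M ι : Type*} [Field K] [DecidableEq ι] [AddCommGroup M] [Module K M]
    (A : Submodule K M) (a z : ι) :
    finrank K ↥(⨆ _ : a = z, A) = (Pi.single a (finrank K A) : ι → ℕ) z := by
  rcases eq_or_ne a z with rfl | h
  · rw [iSup_pos rfl, Pi.single_eq_same]
  · rw [iSup_neg h, finrank_bot, Pi.single_eq_of_ne h.symm]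

theorem finrank_eigenspace_of_isCompl {K M : Type*} [Field K] [DecidableEq K] [AddCommGroup M]
    [Module K M] [FiniteDimensional K M] {T : End K M} {A B : Submodule K M} (h : IsCompl A B)
    {a b : K} (hA : ∀ x ∈ A, T x = a • x) (hB : ∀ x ∈ B, T x = b • x) (z : K) :
    finrank K (End.eigenspace T z) =
      (Pi.single a (finrank K A) + Pi.single b (finrank K B) : K → ℕ) z := by
  have hdisj : Disjoint (⨆ _ : a = z, A) (⨆ _ : b = z, B) :=
    h.disjoint.mono iSup_const_le iSup_const_le
  have hsup := Submodule.finrank_sup_add_finrank_inf_eq (⨆ _ : a = z, A) (⨆ _ : b = z, B)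
  rw [hdisj.eq_bot, finrank_bot, add_zero, finrank_iSup_prop, finrank_iSup_prop] at hsup
  rw [eigenspace_eq_of_isCompl h hA hB, hsup, Pi.add_apply]

variable {n : ℕ} (α β : ℝ) (l : Space n →L[ℝ] ℝ) (p : ℕ)

/-- The symbol `4 π² (α l ∧ (l^♯ ⌟ ·) + β l^♯ ⌟ (l ∧ ·))` of `α d δ + β δ d`: the operator by which
`α d δ + β δ d` acts on the Fourier coefficients at the frequency `l`. -/
noncomputable def symbol : End ℂ (Alt ℂ n (p + 1)) :=
  (4 * Real.pi ^ 2 : ℂ) • ((α : ℂ) • (wedge l p ∘ₗ contract (sharp l) p) +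
    (β : ℂ) • (contract (sharp l) (p + 1) ∘ₗ wedge l (p + 1)))

theorem symbol_apply (η : Alt ℂ n (p + 1)) :
    symbol α β l p η = (4 * Real.pi ^ 2 : ℂ) •
      ((α : ℂ) • wedge l p (contract (sharp l) p η) +
        (β : ℂ) • contract (sharp l) (p + 1) (wedge l (p + 1) η)) := rfl

variable {l p}

theorem symbol_of_mem_range_wedge {η : Alt ℂ n (p + 1)} (h : η ∈ LinearMap.range (wedge l p)) :
    symbol α β l p η = ((4 * Real.pi ^ 2 * α * ‖l‖ ^ 2 : ℝ) : ℂ) • η := by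
  have hη : wedge l (p + 1) η = 0 := by
    obtain ⟨θ, rfl⟩ := h
    exact wedge_wedge l θ
  have cartan := contract_sharp_wedge_add l η
  rw [hη, map_zero, zero_add] at cartan
  rw [symbol_apply, cartan, hη, map_zero, smul_zero (A := Alt ℂ n (p + 1)) (β : ℂ), add_zero,
    smul_smul, smul_smul]
  congr 1
  push_cast
  ring

theorem symbol_of_mem_ker_contract {η : Alt ℂ n (p + 1)}
    (h : η ∈ LinearMap.ker (contract (sharp l) p)) :
    symbol α β l p η = ((4 * Real.pi ^ 2 * β * ‖l‖ ^ 2 : ℝ) : ℂ) • η := by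
  have cartan := contract_sharp_wedge_add l η
  rw [LinearMap.mem_ker.1 h, map_zero, add_zero] at cartan
  rw [symbol_apply, cartan, LinearMap.mem_ker.1 h, map_zero,
    smul_zero (A := Alt ℂ n (p + 1)) (α : ℂ), zero_add, smul_smul, smul_smul]
  congr 1
  push_cast
  ring

theorem symbol_zero : symbol α β (0 : Space n →L[ℝ] ℝ) p = 0 := by
  simp [symbol, wedge_zero]

variable (l p)

theorem eigenspace_symbol (z : ℂ) :
    End.eigenspace (symbol α β l p) z =
      (⨆ _ : ((4 * Real.pi ^ 2 * α * ‖l‖ ^ 2 : ℝ) : ℂ) = z, LinearMap.range (wedge l p)) ⊔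
      ⨆ _ : ((4 * Real.pi ^ 2 * β * ‖l‖ ^ 2 : ℝ) : ℂ) = z,
        LinearMap.ker (contract (sharp l) p) :=
  eigenspace_eq_of_isCompl (isCompl_range_wedge_ker_contract l)
    (fun _ => symbol_of_mem_range_wedge α β) (fun _ => symbol_of_mem_ker_contract α β) z

theorem finrank_eigenspace_symbol (hn : 1 ≤ n) (z : ℂ) :
    finrank ℂ (End.eigenspace (symbol α β l p) z) =
      weightedSingle (4 * Real.pi ^ 2 * α * ‖l‖ ^ 2 : ℝ) ((n - 1).choose p) z +
      weightedSingle (4 * Real.pi ^ 2 * β * ‖l‖ ^ 2 : ℝ) ((n - 1).choose (p + 1)) z := by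
  rcases eq_or_ne l 0 with rfl | hl
  · obtain ⟨m, rfl⟩ := Nat.exists_eq_add_of_le' hn
    have h := finrank_eigenspace_of_isCompl (T := (0 : End ℂ (Alt ℂ (m + 1) (p + 1))))
      isCompl_top_bot (a := 0) (b := 0) (by simp) (by simp) z
    rw [symbol_zero, h, finrank_top, finrank_bot, finrank_alt, Nat.choose_succ_succ', Pi.single_add]
    simp [weightedSingle]
  · rw [finrank_eigenspace_of_isCompl (isCompl_range_wedge_ker_contract l)
      (fun _ => symbol_of_mem_range_wedge α β) (fun _ => symbol_of_mem_ker_contract α β) z,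
      finrank_range_wedge hn hl, finrank_ker_contract_sharp hn hl]
    rfl

end Symbol

section Characters

variable {n : ℕ} {b : Module.Basis (Fin n) ℝ (Space n)}

theorem chi_add (l m : dualLattice b) (t : Torus b) : chi (l + m) t = chi l t * chi m t := by
  obtain ⟨x, rfl⟩ := Submodule.Quotient.mk_surjective _ t
  change chi (l + m) (proj b x) = chi l (proj b x) * chi m (proj b x)
  rw [chi_proj, chi_proj, chi_proj, ← Complex.exp_add]
  congr 1
  simp
  ring

theorem chi_zero (t : Torus b) : chi (0 : dualLattice b) t = 1 := by
  obtain ⟨x, rfl⟩ := Submodule.Quotient.mk_surjective _ t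
  change chi 0 (proj b x) = 1
  simp [chi_proj]

theorem proj_add_mem (x : Space n) {v : Space n} (hv : v ∈ lattice b) :
    proj b (x + v) = proj b x := by
  rw [proj, proj, Submodule.Quotient.eq]
  simpa using hv

theorem fderiv_chi (l : dualLattice b) (x w : Space n) :
    fderiv ℝ (fun x => chi l (proj b x)) x w =
      2 * Real.pi * Complex.I * (l.1 w : ℂ) * chi l (proj b x) := by
  have h : HasFDerivAt (fun x => Complex.exp (2 * Real.pi * Complex.I * (l.1 x : ℂ))) _ x :=
    (((Complex.ofRealCLM.hasFDerivAt (x := l.1 x)).comp x l.1.hasFDerivAt).const_mul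
      (2 * Real.pi * Complex.I)).cexp
  simp only [chi_proj]
  rw [h.fderiv]
  simp
  ring

theorem integral_chi_of_ne_zero {l : dualLattice b} (hl : l ≠ 0) :
    ∫ x in ZSpan.fundamentalDomain b, chi l (proj b x) = 0 := by
  obtain ⟨w, hw⟩ : ∃ w, l.1 w ≠ 0 := by
    by_contra! h
    exact hl (Subtype.ext (ContinuousLinearMap.ext h))
  have h := integral_fderiv_eq_zero _ (contDiff_chi l) b
    (fun x v hv => by rw [proj_add_mem x hv]) w
  simp only [fderiv_chi] at h
  rw [integral_const_mul] at h
  refine (mul_eq_zero.1 h).resolve_left ?_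
  simp [hw, Real.pi_ne_zero]

theorem measureReal_fundamentalDomain_ne_zero (b : Module.Basis (Fin n) ℝ (Space n)) :
    volume.real (ZSpan.fundamentalDomain b) ≠ 0 :=
  ENNReal.toReal_ne_zero.2 ⟨ZSpan.measure_fundamentalDomain_ne_zero b,
    (ZSpan.fundamentalDomain_isBounded b).measure_lt_top.ne⟩

end Characters

section FourierCoefficients

variable {n : ℕ} {b : Module.Basis (Fin n) ℝ (Space n)}
variable {E F : Type} [NormedAddCommGroup E] [NormedSpace ℝ E]

theorem integral_fderiv_apply_eq_zero [CompleteSpace E] {f : Space n → E}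
    (hf : ContDiff ℝ (⊤ : ℕ∞) f) (hper : ∀ x, ∀ v ∈ lattice b, f (x + v) = f x) (w : Space n) :
    ∫ x in ZSpan.fundamentalDomain b, fderiv ℝ f x w = 0 := by
  refine SeparatingDual.eq_zero_of_forall_dual_eq_zero (R := ℝ) fun φ => ?_
  have hint : IntegrableOn (fun x => fderiv ℝ f x w) (ZSpan.fundamentalDomain b) :=
    integrableOn_fundamentalDomain _
      ((hf.continuous_fderiv (by simp)).clm_apply continuous_const) b
  have hφ (x) : fderiv ℝ (fun x => φ (f x)) x w = φ (fderiv ℝ f x w) := by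
    have h := φ.hasFDerivAt.comp x (hf.differentiable (by simp) x).hasFDerivAt
    exact congrArg (· w) h.fderiv
  rw [← φ.integral_comp_comm hint, ← integral_fderiv_eq_zero _ (φ.contDiff.comp hf) b
    (fun x v hv => congrArg φ (hper x v hv)) w]
  exact integral_congr_ae (.of_forall fun x => (hφ x).symm)

variable [NormedSpace ℂ E] [NormedAddCommGroup F] [NormedSpace ℝ F] [NormedSpace ℂ F]

/-- The `l`-th Fourier coefficient of a periodic function on `ℝⁿ`, the periods being the lattice
spanned by `b`. -/
noncomputable def torusFourierCoeff (l : dualLattice b) (f : Space n → E) : E :=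
  (volume.real (ZSpan.fundamentalDomain b) : ℂ)⁻¹ •
    ∫ x in ZSpan.fundamentalDomain b, chi (-l) (proj b x) • f x

theorem integrableOn_chi_smul (l : dualLattice b) {f : Space n → E} (hf : Continuous f) :
    IntegrableOn (fun x => chi l (proj b x) • f x) (ZSpan.fundamentalDomain b) :=
  integrableOn_fundamentalDomain _ ((contDiff_chi l).continuous.smul hf) b

theorem torusFourierCoeff_add (l : dualLattice b) {f g : Space n → E} (hf : Continuous f)
    (hg : Continuous g) :
    torusFourierCoeff l (f + g) = torusFourierCoeff l f + torusFourierCoeff l g := by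
  simp only [torusFourierCoeff, Pi.add_apply, smul_add]
  rw [integral_add (integrableOn_chi_smul _ hf) (integrableOn_chi_smul _ hg), smul_add]

theorem torusFourierCoeff_const_smul [SMulCommClass ℝ ℂ E] (l : dualLattice b) (c : ℂ)
    (f : Space n → E) : torusFourierCoeff l (c • f) = c • torusFourierCoeff l f := by
  simp only [torusFourierCoeff, Pi.smul_apply, smul_comm _ c]
  rw [integral_smul, smul_comm]

theorem torusFourierCoeff_comp [CompleteSpace E] [CompleteSpace F] (l : dualLattice b)
    (L : E →L[ℝ] F) (hL : ∀ (c : ℂ) x, L (c • x) = c • L x) {f : Space n → E} (hf : Continuous f) :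
    torusFourierCoeff l (fun x => L (f x)) = L (torusFourierCoeff l f) := by
  simp only [torusFourierCoeff, hL, ← L.integral_comp_comm (integrableOn_chi_smul _ hf)]

open scoped Classical in
theorem torusFourierCoeff_chi_smul [CompleteSpace E] (l m : dualLattice b) (a : E) :
    torusFourierCoeff m (fun x => chi l (proj b x) • a) = if m = l then a else 0 := by
  simp only [torusFourierCoeff, smul_smul, ← chi_add]
  rw [integral_smul_const]
  split_ifs with hml
  · have hV : (volume.real (ZSpan.fundamentalDomain b) : ℂ) ≠ 0 :=
      Complex.ofReal_ne_zero.2 (measureReal_fundamentalDomain_ne_zero b)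
    simp only [hml, neg_add_cancel, chi_zero]
    rw [setIntegral_const, Complex.real_smul, mul_one, inv_smul_smul₀ hV]
  · rw [integral_chi_of_ne_zero (fun h => hml (neg_add_eq_zero.1 h)), zero_smul, smul_zero]

variable [IsScalarTower ℝ ℂ E] [SMulCommClass ℝ ℂ E] [CompleteSpace E]

theorem torusFourierCoeff_fderiv_apply (l : dualLattice b) {f : Space n → E}
    (hf : ContDiff ℝ (⊤ : ℕ∞) f) (hper : ∀ x, ∀ v ∈ lattice b, f (x + v) = f x) (w : Space n) :
    torusFourierCoeff l (fun x => fderiv ℝ f x w) =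
      (2 * Real.pi * Complex.I * (l.1 w : ℂ)) • torusFourierCoeff l f := by
  have leibniz (x) : fderiv ℝ (fun x => chi (-l) (proj b x) • f x) x w =
      chi (-l) (proj b x) • fderiv ℝ f x w -
        (2 * Real.pi * Complex.I * (l.1 w : ℂ)) • chi (-l) (proj b x) • f x := by
    rw [fderiv_fun_smul ((contDiff_chi (-l)).differentiable (by simp) x)
      (hf.differentiable (by simp) x), add_apply, smul_apply,
      ContinuousLinearMap.smulRight_apply, fderiv_chi, smul_smul, sub_eq_add_neg, ← neg_smul]
    congr 2
    simp
  have h := integral_fderiv_apply_eq_zero (f := fun x => chi (-l) (proj b x) • f x)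
    ((contDiff_chi (-l)).smul hf) (fun x v hv => by rw [hper x v hv, proj_add_mem x hv]) w
  simp only [leibniz] at h
  rw [integral_sub (integrableOn_chi_smul _
      ((hf.continuous_fderiv (by simp)).clm_apply continuous_const))
    ((integrableOn_chi_smul _ hf.continuous).fun_smul _), integral_smul, sub_eq_zero] at h
  rw [torusFourierCoeff, torusFourierCoeff, h, smul_comm]

theorem torusFourierCoeff_fderiv (l : dualLattice b) {f : Space n → E}
    (hf : ContDiff ℝ (⊤ : ℕ∞) f) (hper : ∀ x, ∀ v ∈ lattice b, f (x + v) = f x) :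
    torusFourierCoeff l (fderiv ℝ f) =
      (2 * Real.pi * Complex.I : ℂ) • l.1.smulRight (torusFourierCoeff l f) := by
  ext w
  rw [smul_apply, ContinuousLinearMap.smulRight_apply, ← algebraMap_smul ℂ (l.1 w), smul_smul]
  exact (torusFourierCoeff_comp l (ContinuousLinearMap.apply ℝ E w) (fun _ _ => rfl)
    (hf.continuous_fderiv (by simp))).symm.trans (torusFourierCoeff_fderiv_apply l hf hper w)

end FourierCoefficients

section FormCoefficients

open ContinuousAlternatingMap (alternatizeUncurryFinCLM alternatizeUncurryFin_smul)

variable {n p : ℕ} {b : Module.Basis (Fin n) ℝ (Space n)}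

/-- The `l`-th Fourier coefficient of a form on the torus, as a parallel form. -/
noncomputable def formCoeff (l : dualLattice b) : Form ℂ b p →ₗ[ℂ] Alt ℂ n p where
  toFun ω := torusFourierCoeff l (pull ω)
  map_add' ω η := torusFourierCoeff_add l (contDiff_pull ω).continuous (contDiff_pull η).continuous
  map_smul' c ω := torusFourierCoeff_const_smul l c (pull ω)

theorem formCoeff_apply (l : dualLattice b) (ω : Form ℂ b p) (v : Fin p → Space n) :
    formCoeff l ω v = torusFourierCoeff l (fun x => pull ω x v) :=
  (torusFourierCoeff_comp l (ContinuousAlternatingMap.apply ℝ (Space n) ℂ v) (fun _ _ => rfl)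
    (contDiff_pull ω).continuous).symm

theorem torusFourierCoeff_fderiv_pull (l : dualLattice b) (ω : Form ℂ b p) :
    torusFourierCoeff l (fderiv ℝ (pull ω)) =
      (2 * Real.pi * Complex.I : ℂ) • l.1.smulRight (formCoeff l ω) :=
  torusFourierCoeff_fderiv l (contDiff_pull ω) fun x _ hv => pull_add_mem ω x hv

theorem formCoeff_extD (l : dualLattice b) (ω : Form ℂ b p) :
    formCoeff l (extD ω) = (2 * Real.pi * Complex.I : ℂ) • wedge l.1 p (formCoeff l ω) := by
  have h := torusFourierCoeff_comp l (alternatizeUncurryFinCLM ℝ (Space n) ℂ (n := p))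
    (fun c f => alternatizeUncurryFin_smul c f) (contDiff_fderiv_pull ω).continuous
  rw [torusFourierCoeff_fderiv_pull] at h
  exact h.trans (alternatizeUncurryFin_smul _ _)

theorem sharp_eq_sum (l : Space n →L[ℝ] ℝ) : sharp l = ∑ i, l (stdVec i) • stdVec i := by
  rw [← (EuclideanSpace.basisFun (Fin n) ℝ).sum_repr' (sharp l)]
  refine Finset.sum_congr rfl fun i _ => ?_
  rw [real_inner_comm, sharp, InnerProductSpace.toDual_symm_apply, EuclideanSpace.basisFun_apply]

/-- The map `f ↦ -∑ᵢ eᵢ ⌟ f(eᵢ)`, which yields the codifferential of a form when applied to its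
derivative. -/
noncomputable def divCLM (n p : ℕ) : (Space n →L[ℝ] Alt ℂ n (p + 1)) →L[ℝ] Alt ℂ n p :=
  ∑ i : Fin n, (contractCLM (-stdVec i)).comp (ContinuousLinearMap.apply ℝ _ (stdVec i))

theorem divCLM_apply (f : Space n →L[ℝ] Alt ℂ n (p + 1)) :
    divCLM n p f = -∑ i : Fin n, contract (stdVec i) p (f (stdVec i)) := by
  rw [divCLM, sum_apply, ← Finset.sum_neg_distrib]
  exact Finset.sum_congr rfl fun i _ => map_neg (f (stdVec i)).curryLeft (stdVec i)

theorem divCLM_smul (c : ℂ) (f : Space n →L[ℝ] Alt ℂ n (p + 1)) :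
    divCLM n p (c • f) = c • divCLM n p f := by
  simp only [divCLM_apply, smul_apply, map_smul, smul_neg, Finset.smul_sum]

theorem divCLM_smulRight (l : Space n →L[ℝ] ℝ) (φ : Alt ℂ n (p + 1)) :
    divCLM n p (l.smulRight φ) = -contract (sharp l) p φ := by
  rw [divCLM_apply, neg_inj, sharp_eq_sum]
  refine Eq.trans ?_ (map_sum φ.curryLeft _ _).symm
  exact Finset.sum_congr rfl fun i _ => (map_smul φ.curryLeft (l (stdVec i)) (stdVec i)).symm

theorem formCoeff_codiff (l : dualLattice b) (ω : Form ℂ b (p + 1)) :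
    formCoeff l (codiff ω) =
      -(2 * Real.pi * Complex.I : ℂ) • contract (sharp l.1) p (formCoeff l ω) := by
  have h := torusFourierCoeff_comp l (divCLM n p) divCLM_smul (contDiff_fderiv_pull ω).continuous
  rw [torusFourierCoeff_fderiv_pull, divCLM_smul, divCLM_smulRight,
    smul_neg (A := Alt ℂ n p), ← neg_smul _ (_ : Alt ℂ n p)] at h
  rw [codiff_eq_divLin, ← h]
  exact congrArg (torusFourierCoeff l) (funext fun x => (divCLM_apply (fderiv ℝ (pull ω) x)).symm)

theorem formCoeff_genHodge (α β : ℝ) (l : dualLattice b) (ω : Form ℂ b (p + 1)) :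
    formCoeff l (genHodge ℂ b α β (p + 1) ω) = symbol α β l.1 p (formCoeff l ω) := by
  have two_pi_I_sq : 2 * Real.pi * Complex.I * -(2 * Real.pi * Complex.I) =
      (4 * Real.pi ^ 2 : ℂ) := by
    linear_combination (-4 * Real.pi ^ 2 : ℂ) * Complex.I_sq
  change formCoeff l ((α : ℂ) • extD (codiff ω) + (β : ℂ) • codiff (extD ω)) = _
  rw [symbol_apply, map_add, map_smul, map_smul, formCoeff_extD, formCoeff_codiff,
    formCoeff_codiff, formCoeff_extD, map_smul, map_smul, smul_smul (M := ℂ) _ _ (wedge _ _ _),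
    smul_smul (M := ℂ) _ _ (contract _ _ _), mul_comm (-_), two_pi_I_sq,
    smul_add _ (_ : Alt ℂ n (p + 1)) _, smul_comm (α : ℂ) _ (_ : Alt ℂ n (p + 1)),
    smul_comm (β : ℂ) _ (_ : Alt ℂ n (p + 1))]

open scoped Classical in
theorem formCoeff_chiMul (l m : dualLattice b) (φ : Alt ℂ n p) :
    formCoeff m (chiMul l p φ) = if m = l then φ else 0 :=
  torusFourierCoeff_chi_smul l m φ

end FormCoefficients

section Completeness

theorem integral_mul_eq_zero_of_span_dense {X Y : Type*} [TopologicalSpace X] [CompactSpace X]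
    [TopologicalSpace Y] [MeasurableSpace Y] [OpensMeasurableSpace Y] {μ : Measure Y}
    (T : C(Y, X)) {f : Y → ℂ} (hf : Integrable f μ) {S : Set C(X, ℂ)}
    (hS : (Submodule.span ℂ S).topologicalClosure = ⊤)
    (h : ∀ g ∈ S, ∫ y, g (T y) * f y ∂μ = 0) (g : C(X, ℂ)) : ∫ y, g (T y) * f y ∂μ = 0 := by
  have hint (g : C(X, ℂ)) : Integrable (fun y => g (T y) * f y) μ :=
    hf.bdd_mul (c := ‖g‖) (g.continuous.comp T.continuous).aestronglyMeasurable
      (.of_forall fun y => g.norm_coe_le_norm (T y))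
  let Φ₀ : C(X, ℂ) →ₗ[ℂ] ℂ :=
    { toFun := fun g => ∫ y, g (T y) * f y ∂μ
      map_add' := fun g g' => by
        simp only [ContinuousMap.add_apply, add_mul, integral_add (hint g) (hint g')]
      map_smul' := fun c g => by
        simp only [ContinuousMap.smul_apply, smul_eq_mul, mul_assoc, RingHom.id_apply,
          integral_const_mul] }
  let Φ : C(X, ℂ) →L[ℂ] ℂ := Φ₀.mkContinuous (∫ y, ‖f y‖ ∂μ) fun g => by
    rw [mul_comm, ← integral_const_mul]
    refine norm_integral_le_of_norm_le (hf.norm.const_mul ‖g‖) (.of_forall fun y => ?_)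
    rw [norm_mul]
    exact mul_le_mul_of_nonneg_right (g.norm_coe_le_norm (T y)) (norm_nonneg _)
  have ker_eq_top : LinearMap.ker Φ.toLinearMap = ⊤ := by
    rw [eq_top_iff, ← hS]
    exact Submodule.topologicalClosure_minimal _ (Submodule.span_le.2 h) Φ.isClosed_ker
  exact LinearMap.mem_ker.1 (ker_eq_top ▸ Submodule.mem_top (x := g))

variable {n p : ℕ} {b : Module.Basis (Fin n) ℝ (Space n)}

/-- The coordinates with respect to `b`, modulo `ℤ`: the projection from `ℝⁿ` to `ℝⁿ / Λ` followed
by the isomorphism with the standard torus. -/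
noncomputable def toUnitTorus (b : Module.Basis (Fin n) ℝ (Space n)) (x : Space n) :
    UnitAddTorus (Fin n) :=
  fun i => ((b.equivFunL x i : ℝ) : UnitAddCircle)

theorem isQuotientMap_toUnitTorus (b : Module.Basis (Fin n) ℝ (Space n)) :
    Topology.IsQuotientMap (toUnitTorus b) := by
  have hmod : IsOpenQuotientMap (fun (t : Fin n → ℝ) (i : Fin n) => (t i : UnitAddCircle)) :=
    IsOpenQuotientMap.piMap fun _ => QuotientAddGroup.isOpenQuotientMap_mk
  exact (hmod.comp b.equivFunL.toHomeomorph.isOpenQuotientMap).isQuotientMap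

theorem sub_mem_lattice_of_toUnitTorus_eq {x y : Space n} (h : toUnitTorus b x = toUnitTorus b y) :
    x - y ∈ lattice b := by
  rw [b.mem_span_iff_repr_mem ℤ]
  intro i
  have hi : ((b.equivFunL x i : ℝ) : UnitAddCircle) = (b.equivFunL y i : ℝ) := congrFun h i
  rw [← sub_eq_zero, ← AddCircle.coe_sub, AddCircle.coe_eq_zero_iff] at hi
  obtain ⟨m, hm⟩ := hi
  exact ⟨m, by simpa using hm⟩

theorem exists_continuousMap_comp_toUnitTorus {Z : Type*} [TopologicalSpace Z] {f : Space n → Z}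
    (hf : Continuous f) (hper : ∀ x, ∀ v ∈ lattice b, f (x + v) = f x) :
    ∃ g : C(UnitAddTorus (Fin n), Z), ∀ x, g (toUnitTorus b x) = f x := by
  have hT := isQuotientMap_toUnitTorus b
  let T : C(Space n, UnitAddTorus (Fin n)) := ⟨toUnitTorus b, hT.continuous⟩
  have hfac : Function.FactorsThrough (⟨f, hf⟩ : C(Space n, Z)) T := fun x y hxy => by
    have := hper y _ (sub_mem_lattice_of_toUnitTorus_eq hxy)
    rwa [add_sub_cancel] at this
  exact ⟨Topology.IsQuotientMap.lift (f := T) hT ⟨f, hf⟩ hfac,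
    DFunLike.congr_fun (Topology.IsQuotientMap.lift_comp (f := T) hT _ hfac)⟩

/-- The element of the dual lattice with coordinates `m` with respect to the dual basis of `b`. -/
noncomputable def dualOfInt (b : Module.Basis (Fin n) ℝ (Space n)) (m : Fin n → ℤ) :
    dualLattice b :=
  ⟨∑ i, (m i : ℝ) • (ContinuousLinearMap.proj i ∘L (b.equivFunL : Space n →L[ℝ] Fin n → ℝ)), by
    intro v hv
    rw [b.mem_span_iff_repr_mem ℤ] at hv
    choose k hk using hv
    refine ⟨∑ i, m i * k i, ?_⟩
    simp only [sum_apply]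
    push_cast
    refine Finset.sum_congr rfl fun i _ => ?_
    simp [← hk]⟩

theorem mFourier_toUnitTorus (m : Fin n → ℤ) (x : Space n) :
    UnitAddTorus.mFourier m (toUnitTorus b x) = chi (dualOfInt b m) (proj b x) := by
  change ∏ i, fourier (m i) ((b.equivFunL x i : ℝ) : UnitAddCircle) = _
  rw [chi_proj]
  simp only [fourier_coe_apply, dualOfInt, sum_apply]
  rw [← Complex.exp_sum]
  congr 1
  push_cast
  rw [Finset.mul_sum]
  refine Finset.sum_congr rfl fun i _ => ?_
  simp
  ring

theorem integral_star_mul_self_eq_zero_of_torusFourierCoeff {f : Space n → ℂ} (hf : Continuous f)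
    (hper : ∀ x, ∀ v ∈ lattice b, f (x + v) = f x)
    (h0 : ∀ l : dualLattice b, torusFourierCoeff l f = 0) :
    ∫ x in ZSpan.fundamentalDomain b, star (f x) * f x = 0 := by
  obtain ⟨g, hg⟩ := exists_continuousMap_comp_toUnitTorus hf hper
  have orthogonal : ∀ e ∈ Set.range (UnitAddTorus.mFourier (d := Fin n)),
      ∫ x in ZSpan.fundamentalDomain b, e (toUnitTorus b x) * f x = 0 := by
    rintro _ ⟨m, rfl⟩
    have h := h0 (-dualOfInt b m)
    rw [torusFourierCoeff, neg_neg] at h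
    simp only [mFourier_toUnitTorus]
    exact (smul_eq_zero.1 h).resolve_left
      (inv_ne_zero (Complex.ofReal_ne_zero.2 (measureReal_fundamentalDomain_ne_zero b)))
  simpa only [ContinuousMap.star_apply, ContinuousMap.coe_mk, hg] using
    integral_mul_eq_zero_of_span_dense
      ⟨toUnitTorus b, (isQuotientMap_toUnitTorus b).continuous⟩
      (integrableOn_fundamentalDomain f hf b) UnitAddTorus.span_mFourier_closure_eq_top
      orthogonal (star g)

theorem eq_zero_of_forall_formCoeff_eq_zero {ω : Form ℂ b p} (h : ∀ l, formCoeff l ω = 0) :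
    ω = 0 := by
  have hcont (v : Fin p → Space n) : Continuous fun x => pull ω x v :=
    (pull_apply_contDiff ω v).continuous
  have hzero (v : Fin p → Space n) :
      ∫ x in ZSpan.fundamentalDomain b, inner ℂ (pull ω x v) (pull ω x v) = 0 := by
    simp only [RCLike.inner_apply', starRingEnd_apply]
    refine integral_star_mul_self_eq_zero_of_torusFourierCoeff (hcont v)
      (fun x w hw => by rw [pull_add_mem ω x hw]) fun l => ?_
    rw [← formCoeff_apply, h]
    rfl
  apply form_eq_zero_of_l2Inner_self
  change ∫ x in ZSpan.fundamentalDomain b, altInner (pull ω x) (pull ω x) = 0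
  simp only [altInner]
  rw [integral_const_mul, integral_finsetSum _ fun I _ =>
    integrableOn_fundamentalDomain _ ((hcont _).inner (hcont _)) b]
  simp only [hzero, Finset.sum_const_zero, mul_zero]

theorem form_ext_formCoeff {ω η : Form ℂ b p} (h : ∀ l, formCoeff l ω = formCoeff l η) :
    ω = η := by
  rw [← sub_eq_zero]
  refine eq_zero_of_forall_formCoeff_eq_zero fun l => ?_
  rw [map_sub, h, sub_self]

theorem genHodge_chiMul (α β : ℝ) (l : dualLattice b) (φ : Alt ℂ n (p + 1)) :
    genHodge ℂ b α β (p + 1) (chiMul l (p + 1) φ) = chiMul l (p + 1) (symbol α β l.1 p φ) := by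
  classical
  refine form_ext_formCoeff fun m => ?_
  rw [formCoeff_genHodge, formCoeff_chiMul, formCoeff_chiMul]
  split_ifs with h
  · rw [h]
  · exact map_zero _

end Completeness

section Eigenspaces

variable {n p : ℕ} {b : Module.Basis (Fin n) ℝ (Space n)} {α β : ℝ}

theorem finite_norm_le (b : Module.Basis (Fin n) ℝ (Space n)) (r : ℝ) :
    {l : dualLattice b | ‖l.1‖ ≤ r}.Finite := by
  have int_values : ∀ (l : dualLattice b) (i : Fin n), ∃ m : ℤ, l.1 (b i) = m := fun l i =>
    l.2 _ (Submodule.subset_span ⟨i, rfl⟩)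
  choose k hk using int_values
  have injective_k : Function.Injective k := by
    intro l l' h
    refine Subtype.ext (ContinuousLinearMap.coe_injective (b.ext fun i => ?_))
    change l.1 (b i) = l'.1 (b i)
    rw [hk, hk, h]
  refine Set.Finite.of_finite_image (f := k) ?_ injective_k.injOn
  refine (Set.Finite.pi' (t := fun i : Fin n => Set.Icc (-⌈r * ‖b i‖⌉) ⌈r * ‖b i‖⌉)
    fun i => Set.finite_Icc _ _).subset ?_
  rintro _ ⟨l, hl, rfl⟩ i
  have norm_bound : |l.1 (b i)| ≤ r * ‖b i‖ :=
    (l.1.le_opNorm (b i)).trans (mul_le_mul_of_nonneg_right hl (norm_nonneg _))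
  rw [hk, ← Int.cast_abs] at norm_bound
  rw [Set.mem_Icc, ← abs_le]
  exact_mod_cast norm_bound.trans (Int.le_ceil _)

theorem lam_eq_lam_iff_norm_eq_sqrt {γ γ' : ℝ} (h : 0 < γ / γ') {l k : dualLattice b} :
    lam γ' l = lam γ k ↔ ‖l.1‖ = √(γ / γ') * ‖k.1‖ := by
  have hγ' : γ' ≠ 0 := (div_ne_zero_iff.1 h.ne').2
  have lam_eq : lam γ k = 4 * Real.pi ^ 2 * γ' * (√(γ / γ') * ‖k.1‖) ^ 2 := by
    rw [lam, mul_pow, Real.sq_sqrt h.le]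
    field_simp
  rw [lam_eq, lam, mul_right_inj' (by positivity), sq_eq_sq₀ (norm_nonneg _) (by positivity)]

theorem lam_eq_lam_iff {γ : ℝ} (hγ : γ ≠ 0) {l k : dualLattice b} :
    lam γ l = lam γ k ↔ ‖l.1‖ = ‖k.1‖ := by
  have h := lam_eq_lam_iff_norm_eq_sqrt (γ := γ) (γ' := γ) (l := l) (k := k)
  rw [div_self hγ, Real.sqrt_one, one_mul] at h
  exact h one_pos

theorem finite_lam_eq (b : Module.Basis (Fin n) ℝ (Space n)) {γ : ℝ} (hγ : γ ≠ 0) (z : ℂ) :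
    {l : dualLattice b | (lam γ l : ℂ) = z}.Finite := by
  by_cases h : ∃ k : dualLattice b, (lam γ k : ℂ) = z
  · obtain ⟨k, rfl⟩ := h
    exact (finite_norm_le b ‖k.1‖).subset fun l hl =>
      ((lam_eq_lam_iff hγ).1 (Complex.ofReal_injective hl)).le
  · exact Set.finite_empty.subset fun l hl => h ⟨l, hl⟩

theorem finite_setOf_eigenspace_symbol_ne_bot (b : Module.Basis (Fin n) ℝ (Space n))
    (hα : α ≠ 0) (hβ : β ≠ 0) (p : ℕ) (z : ℂ) :
    {l : dualLattice b | Module.End.eigenspace (symbol α β l.1 p) z ≠ ⊥}.Finite := by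
  refine ((finite_lam_eq b hα z).union (finite_lam_eq b hβ z)).subset fun l hl => ?_
  by_contra h
  obtain ⟨hlα, hlβ⟩ : (lam α l : ℂ) ≠ z ∧ (lam β l : ℂ) ≠ z := not_or.1 h
  rw [lam] at hlα hlβ
  exact hl (by rw [eigenspace_symbol, iSup_neg hlα, iSup_neg hlβ, sup_bot_eq])

theorem mem_Eig_iff {z : ℂ} {ω : Form ℂ b (p + 1)} :
    ω ∈ Eig ℂ b α β (p + 1) z ↔
      ∀ l, formCoeff l ω ∈ Module.End.eigenspace (symbol α β l.1 p) z := by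
  simp only [Eig, Module.End.mem_eigenspace_iff, ← formCoeff_genHodge, ← map_smul]
  exact ⟨fun h l => by rw [h], form_ext_formCoeff⟩

theorem map_chiMul_eigenspace_symbol_le_Eig (l : dualLattice b) (z : ℂ) :
    (Module.End.eigenspace (symbol α β l.1 p) z).map (chiMul l (p + 1)) ≤
      Eig ℂ b α β (p + 1) z := by
  rintro _ ⟨φ, hφ, rfl⟩
  rw [Module.End.mem_eigenspace_iff, genHodge_chiMul, Module.End.mem_eigenspace_iff.1 hφ, map_smul]

theorem sum_chiMul_formCoeff {S : Finset (dualLattice b)} {ω : Form ℂ b p}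
    (h : ∀ l ∉ S, formCoeff l ω = 0) : ∑ l ∈ S, chiMul l p (formCoeff l ω) = ω := by
  classical
  refine form_ext_formCoeff fun m => ?_
  simp only [map_sum, formCoeff_chiMul, Finset.sum_ite_eq]
  split_ifs with hm
  · rfl
  · exact (h m hm).symm

theorem sum_chiMul_formCoeff_of_mem_Eig {z : ℂ} {S : Finset (dualLattice b)}
    (hS : ∀ l ∉ S, Module.End.eigenspace (symbol α β l.1 p) z = ⊥) {ω : Form ℂ b (p + 1)}
    (hω : ω ∈ Eig ℂ b α β (p + 1) z) : ∑ l ∈ S, chiMul l (p + 1) (formCoeff l ω) = ω :=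
  sum_chiMul_formCoeff fun l hl => by
    have h := mem_Eig_iff.1 hω l
    rwa [hS l hl, Submodule.mem_bot] at h

/-- The Fourier coefficients of an eigenform with frequencies in `S` are arbitrary eigenvectors of
the symbols. -/
noncomputable def eigEquiv {z : ℂ} (S : Finset (dualLattice b))
    (hS : ∀ l ∉ S, Module.End.eigenspace (symbol α β l.1 p) z = ⊥) :
    Eig ℂ b α β (p + 1) z ≃ₗ[ℂ] ∀ l : S, Module.End.eigenspace (symbol α β l.1.1 p) z where
  __ := LinearMap.pi fun l : S =>
    (formCoeff l.1).restrict (p := Eig ℂ b α β (p + 1) z) fun _ hω => mem_Eig_iff.1 hω l.1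
  invFun η := ⟨∑ l : S, chiMul l.1 (p + 1) (η l).1, Submodule.sum_mem _ fun l _ =>
    map_chiMul_eigenspace_symbol_le_Eig l.1 z ⟨_, (η l).2, rfl⟩⟩
  left_inv ω := Subtype.ext <|
    (Finset.sum_coe_sort S fun l => chiMul l (p + 1) (formCoeff l ω.1)).trans
      (sum_chiMul_formCoeff_of_mem_Eig hS ω.2)
  right_inv η := by
    classical
    refine funext fun m => Subtype.ext ?_
    change formCoeff m.1 (∑ l : S, chiMul l.1 (p + 1) (η l).1) = (η m).1
    simp only [map_sum, formCoeff_chiMul, Subtype.coe_inj, Finset.sum_ite_eq, Finset.mem_univ,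
      if_true]

theorem finiteDimensional_Eig (hα : α ≠ 0) (hβ : β ≠ 0) (z : ℂ) :
    FiniteDimensional ℂ (Eig ℂ b α β (p + 1) z) := by
  have h := finite_setOf_eigenspace_symbol_ne_bot b hα hβ p z
  exact (eigEquiv h.toFinset (by simp)).symm.finiteDimensional

theorem finrank_Eig (hα : α ≠ 0) (hβ : β ≠ 0) (z : ℂ) :
    Module.finrank ℂ (Eig ℂ b α β (p + 1) z) =
      ∑ᶠ l : dualLattice b, Module.finrank ℂ (Module.End.eigenspace (symbol α β l.1 p) z) := by
  have h := finite_setOf_eigenspace_symbol_ne_bot b hα hβ p z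
  rw [(eigEquiv h.toFinset (by simp)).finrank_eq, Module.finrank_pi_fintype,
    Finset.sum_coe_sort h.toFinset fun l => Module.finrank ℂ
      (Module.End.eigenspace (symbol α β l.1 p) z), finsum_eq_sum_of_support_subset]
  intro l hl
  rw [Set.Finite.coe_toFinset]
  intro hbot
  exact hl (Submodule.finrank_eq_zero.2 hbot)

theorem finite_support_weightedSingle_lam (b : Module.Basis (Fin n) ℝ (Space n)) {γ : ℝ}
    (hγ : γ ≠ 0) (m : ℕ) (z : ℂ) :
    (Function.support fun l : dualLattice b => weightedSingle (lam γ l) m z).Finite :=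
  (finite_lam_eq b hγ z).subset fun l hl => by
    by_contra h
    exact hl (Pi.single_eq_of_ne (M := fun _ => ℕ) (Ne.symm h) m)

theorem spec_eq (hn : 1 ≤ n) (hα : α ≠ 0) (hβ : β ≠ 0) :
    spec b α β (p + 1) =
      weightedUnion (fun l : dualLattice b => weightedSingle (lam α l) ((n - 1).choose p)) +
      weightedUnion (fun l : dualLattice b =>
        weightedSingle (lam β l) ((n - 1).choose (p + 1))) := by
  funext z
  calc spec b α β (p + 1) z
      = ∑ᶠ l : dualLattice b, Module.finrank ℂ (Module.End.eigenspace (symbol α β l.1 p) z) :=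
        finrank_Eig hα hβ z
    _ = ∑ᶠ l : dualLattice b, (weightedSingle (lam α l) ((n - 1).choose p) z +
          weightedSingle (lam β l) ((n - 1).choose (p + 1)) z) :=
        finsum_congr fun l => finrank_eigenspace_symbol α β l.1 p hn z
    _ = _ := finsum_add_distrib (finite_support_weightedSingle_lam b hα _ z)
        (finite_support_weightedSingle_lam b hβ _ z)

theorem Eig_eq_iSup_map_chiMul (hα : α ≠ 0) (hβ : β ≠ 0) (z : ℂ) :
    Eig ℂ b α β (p + 1) z = ⨆ l : dualLattice b,
      (Module.End.eigenspace (symbol α β l.1 p) z).map (chiMul l (p + 1)) := by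
  refine le_antisymm (fun ω hω => ?_)
    (iSup_le fun l => map_chiMul_eigenspace_symbol_le_Eig l z)
  have h := finite_setOf_eigenspace_symbol_ne_bot b hα hβ p z
  rw [← sum_chiMul_formCoeff_of_mem_Eig (S := h.toFinset) (by simp) hω]
  exact Submodule.sum_mem _ fun l _ =>
    Submodule.mem_iSup_of_mem l ⟨_, mem_Eig_iff.1 hω l, rfl⟩

theorem iSupIndep_of_disjoint {L ι : Type*} [CompleteLattice L] {A B : ι → L}
    (h : ∀ i, Disjoint (A i) (B i)) (h' : ∀ i j, j ≠ i → A j ≤ B i) : iSupIndep A :=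
  fun i => (h i).mono_right (iSup₂_le fun j hj => h' i j hj)

theorem disjoint_map_chiMul_comap_formCoeff (l : dualLattice b) {A B : Submodule ℂ (Alt ℂ n p)}
    (h : Disjoint A B) : Disjoint (A.map (chiMul l p)) (B.comap (formCoeff l)) := by
  classical
  rw [Submodule.disjoint_def]
  rintro _ ⟨φ, hφ, rfl⟩ hφB
  rw [Submodule.mem_comap, formCoeff_chiMul, if_pos rfl] at hφB
  rw [Submodule.disjoint_def.1 h φ hφ hφB, map_zero]

theorem map_chiMul_le_comap_formCoeff {l m : dualLattice b} {A B : Submodule ℂ (Alt ℂ n p)}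
    (h : m = l → A ≤ B) : A.map (chiMul l p) ≤ B.comap (formCoeff m) := by
  classical
  rintro _ ⟨φ, hφ, rfl⟩
  rw [Submodule.mem_comap, formCoeff_chiMul]
  split_ifs with hm
  · exact h hm hφ
  · exact B.zero_mem

theorem iSupIndep_eigFamily (b : Module.Basis (Fin n) ℝ (Space n)) (p : ℕ) (r s : ℝ) :
    iSupIndep (eigFamily b (p + 1) r s) := by
  -- `V l` meets the forms whose coefficient at `l` lies in the complement `ker (l♯ ⌟ ·)` trivially,
  -- and all other members of the family consist of such forms; likewise for `W l`.
  refine iSupIndep_of_disjoint (B := Sum.elim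
    (fun l => (LinearMap.ker (contract (sharp l.1.1) p)).comap (formCoeff l.1))
    (fun l => (LinearMap.range (wedge l.1.1 p)).comap (formCoeff l.1))) ?_ ?_
  · rintro (l | l)
    · exact disjoint_map_chiMul_comap_formCoeff _ (isCompl_range_wedge_ker_contract _).disjoint
    · exact disjoint_map_chiMul_comap_formCoeff _
        (isCompl_range_wedge_ker_contract _).disjoint.symm
  · rintro (l | l) (m | m) hne
    · exact map_chiMul_le_comap_formCoeff fun h =>
        (hne (congrArg Sum.inl (Subtype.ext h.symm))).elim
    · exact map_chiMul_le_comap_formCoeff fun h => by rw [h]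
    · exact map_chiMul_le_comap_formCoeff fun h => by rw [h]
    · exact map_chiMul_le_comap_formCoeff fun h =>
        (hne (congrArg Sum.inr (Subtype.ext h.symm))).elim

theorem isDirectSum_Eig (hα : α ≠ 0) (hβ : β ≠ 0) {z : ℂ} {r s : ℝ}
    (hr : ∀ l : dualLattice b, (lam α l : ℂ) = z ↔ ‖l.1‖ = r)
    (hs : ∀ l : dualLattice b, (lam β l : ℂ) = z ↔ ‖l.1‖ = s) :
    IsDirectSum (Eig ℂ b α β (p + 1) z) (eigFamily b (p + 1) r s) := by
  refine ⟨iSupIndep_eigFamily b p r s, ?_⟩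
  simp only [lam] at hr hs
  simp only [Eig_eq_iSup_map_chiMul hα hβ, eigenspace_symbol, hr, hs, Submodule.map_sup,
    Submodule.map_iSup, iSup_sup_eq, iSup_sum, iSup_subtype, eigFamily, Sum.elim_inl, Sum.elim_inr,
    V, W]

end Eigenspaces

section RealForms

variable {𝕜 𝕜' : Type} [RCLike 𝕜] [RCLike 𝕜'] {n p : ℕ} {b : Module.Basis (Fin n) ℝ (Space n)}

/-- The form `L ∘ ω`, for an `ℝ`-linear map `L` between the fields of values. It is used for real
and imaginary parts and for the inclusion of real in complex forms. -/
noncomputable def mapForm (L : 𝕜 →L[ℝ] 𝕜') (ω : Form 𝕜 b p) : Form 𝕜' b p :=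
  ofPeriodic (fun x => L.compContinuousAlternatingMap (pull ω x))
    ((ContinuousLinearMap.compContinuousAlternatingMapCLM ℝ (Space n) 𝕜 𝕜' (Fin p) L).contDiff.comp
      (contDiff_pull ω))
    (fun x v hv => by rw [pull_add_mem ω x hv])

theorem pull_mapForm_apply (L : 𝕜 →L[ℝ] 𝕜') (ω : Form 𝕜 b p) (x : Space n)
    (v : Fin p → Space n) : pull (mapForm L ω) x v = L (pull ω x v) := rfl

theorem form_ext_pull_apply {ω η : Form 𝕜 b p} (h : ∀ x v, pull ω x v = pull η x v) : ω = η := by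
  ext1 x
  ext v
  exact h x v

theorem mapForm_add (L : 𝕜 →L[ℝ] 𝕜') (ω η : Form 𝕜 b p) :
    mapForm L (ω + η) = mapForm L ω + mapForm L η :=
  form_ext_pull_apply fun x v => map_add L (pull ω x v) (pull η x v)

theorem mapForm_ofReal_smul (L : 𝕜 →L[ℝ] 𝕜') (c : ℝ) (ω : Form 𝕜 b p) :
    mapForm L ((c : 𝕜) • ω) = (c : 𝕜') • mapForm L ω := by
  refine form_ext_pull_apply fun x v => ?_
  change L ((c : 𝕜) • pull ω x v) = (c : 𝕜') • L (pull ω x v)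
  rw [smul_eq_mul, smul_eq_mul, ← RCLike.real_smul_eq_coe_mul, ← RCLike.real_smul_eq_coe_mul,
    map_smul]

theorem fderiv_pull_mapForm_apply (L : 𝕜 →L[ℝ] 𝕜') (ω : Form 𝕜 b p) (x w : Space n)
    (v : Fin p → Space n) :
    fderiv ℝ (pull (mapForm L ω)) x w v = L (fderiv ℝ (pull ω) x w v) := by
  have h : HasFDerivAt (pull (mapForm L ω)) _ x :=
    (ContinuousLinearMap.compContinuousAlternatingMapCLM ℝ (Space n) 𝕜 𝕜' (Fin p)
      L).hasFDerivAt.comp x ((contDiff_pull ω).differentiable (by simp) x).hasFDerivAt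
  rw [h.fderiv]
  rfl

theorem extD_mapForm (L : 𝕜 →L[ℝ] 𝕜') (ω : Form 𝕜 b p) :
    extD (mapForm L ω) = mapForm L (extD ω) := by
  refine form_ext_pull_apply fun x v => ?_
  simp only [pull_mapForm_apply, pull_extD, extDeriv,
    ContinuousAlternatingMap.alternatizeUncurryFin_apply, fderiv_pull_mapForm_apply, map_sum,
    map_zsmul]

theorem codiff_mapForm (L : 𝕜 →L[ℝ] 𝕜') (ω : Form 𝕜 b (p + 1)) :
    codiff (mapForm L ω) = mapForm L (codiff ω) := by
  rw [codiff_eq_divLin, codiff_eq_divLin]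
  refine form_ext_pull_apply fun x v => ?_
  simp only [pull_mapForm_apply, pull_divLin, divFun, ContinuousAlternatingMap.neg_apply,
    ContinuousAlternatingMap.sum_apply, ContinuousAlternatingMap.curryLeft_apply_apply,
    fderiv_pull_mapForm_apply, map_neg, map_sum]

theorem genHodge_mapForm (L : 𝕜 →L[ℝ] 𝕜') (α β : ℝ) (ω : Form 𝕜 b (p + 1)) :
    genHodge 𝕜' b α β (p + 1) (mapForm L ω) = mapForm L (genHodge 𝕜 b α β (p + 1) ω) := by
  change (α : 𝕜') • extD (codiff (mapForm L ω)) + (β : 𝕜') • codiff (extD (mapForm L ω)) =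
    mapForm L ((α : 𝕜) • extD (codiff ω) + (β : 𝕜) • codiff (extD ω))
  simp only [mapForm_add, mapForm_ofReal_smul, codiff_mapForm, extD_mapForm]

theorem mapForm_mem_Eig (L : 𝕜 →L[ℝ] 𝕜') {α β z : ℝ} {ω : Form 𝕜 b (p + 1)}
    (h : ω ∈ Eig 𝕜 b α β (p + 1) (z : 𝕜)) : mapForm L ω ∈ Eig 𝕜' b α β (p + 1) (z : 𝕜') := by
  rw [Module.End.mem_eigenspace_iff] at h ⊢
  rw [genHodge_mapForm, h, mapForm_ofReal_smul]

/-- For a real eigenvalue, complex eigenforms are pairs of real ones, via real and imaginary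
parts. -/
noncomputable def eigRealEquiv (b : Module.Basis (Fin n) ℝ (Space n)) (α β : ℝ) (p : ℕ) (z : ℝ) :
    Eig ℂ b α β (p + 1) (z : ℂ) ≃ₗ[ℝ] Eig ℝ b α β (p + 1) z × Eig ℝ b α β (p + 1) z where
  toFun ω := (⟨mapForm Complex.reCLM ω.1, mapForm_mem_Eig Complex.reCLM ω.2⟩,
    ⟨mapForm Complex.imCLM ω.1, mapForm_mem_Eig Complex.imCLM ω.2⟩)
  map_add' ω η := by
    ext1 <;> exact Subtype.ext (mapForm_add _ _ _)
  map_smul' c ω := by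
    ext1 <;> exact Subtype.ext (mapForm_ofReal_smul _ _ _)
  invFun η := ⟨mapForm Complex.ofRealCLM η.1.1 +
      mapForm (Complex.ofRealCLM.smulRight Complex.I) η.2.1,
    Submodule.add_mem _ (mapForm_mem_Eig Complex.ofRealCLM η.1.2) (mapForm_mem_Eig _ η.2.2)⟩
  left_inv ω := Subtype.ext (form_ext_pull_apply fun x v => Complex.re_add_im (pull ω.1 x v))
  right_inv η := by
    ext1 <;> refine Subtype.ext (form_ext_pull_apply fun x v => ?_)
    · change ((pull η.1.1 x v : ℂ) + (pull η.2.1 x v : ℂ) * Complex.I).re = pull η.1.1 x v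
      simp
    · change ((pull η.1.1 x v : ℂ) + (pull η.2.1 x v : ℂ) * Complex.I).im = pull η.2.1 x v
      simp

variable {α β : ℝ}

theorem finiteDimensional_Eig_real (hα : α ≠ 0) (hβ : β ≠ 0) (z : ℝ) :
    FiniteDimensional ℝ (Eig ℝ b α β (p + 1) z) := by
  have := finiteDimensional_Eig (b := b) (p := p) hα hβ z
  have := FiniteDimensional.complexToReal (Eig ℂ b α β (p + 1) (z : ℂ))
  exact Module.Finite.of_surjective
    (LinearMap.fst ℝ (Eig ℝ b α β (p + 1) z) (Eig ℝ b α β (p + 1) z) ∘ₗ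
      (eigRealEquiv b α β p z).toLinearMap)
    (Prod.fst_surjective.comp (eigRealEquiv b α β p z).surjective)

theorem finrank_Eig_real (hα : α ≠ 0) (hβ : β ≠ 0) (z : ℝ) :
    Module.finrank ℝ (Eig ℝ b α β (p + 1) z) = spec b α β (p + 1) z := by
  have := finiteDimensional_Eig_real (b := b) (p := p) hα hβ z
  have h := (eigRealEquiv b α β p z).finrank_eq
  rw [Module.finrank_prod, finrank_real_of_complex] at h
  rw [spec]
  omega

end RealForms

end FlatTorus

open FlatTorus in
theorem theorem3_general (n : ℕ) (b : Module.Basis (Fin n) ℝ (Space n)) (α β : ℝ) (hα : α ≠ 0)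
    (hβ : β ≠ 0) (p : ℕ) (hp : 1 ≤ p) (hn : 1 ≤ n) :
    (∀ r : ℝ, {l : dualLattice b | ‖l.1‖ = r}.Finite) ∧
    (∀ z : ℂ, FiniteDimensional ℂ (Eig ℂ b α β p z)) ∧
    spec b α β p =
      weightedUnion (fun l : dualLattice b => weightedSingle (lam α l) ((n - 1).choose (p - 1))) +
      weightedUnion (fun l : dualLattice b => weightedSingle (lam β l) ((n - 1).choose p)) ∧
    (∀ z : ℝ, FiniteDimensional ℝ (Eig ℝ b α β p z) ∧
      Module.finrank ℝ (Eig ℝ b α β p z) = spec b α β p z) ∧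
    (0 < α / β → ∀ k : dualLattice b,
      IsDirectSum (Eig ℂ b α β p (lam α k)) (eigFamily b p ‖k.1‖ (√(α / β) * ‖k.1‖)) ∧
      IsDirectSum (Eig ℂ b α β p (lam β k)) (eigFamily b p (√(β / α) * ‖k.1‖) ‖k.1‖)) := by
  obtain ⟨q, rfl⟩ := Nat.exists_eq_add_of_le' hp
  refine ⟨fun r => (finite_norm_le b r).subset fun l hl => le_of_eq hl,
    finiteDimensional_Eig hα hβ, spec_eq hn hα hβ,
    fun z => ⟨finiteDimensional_Eig_real hα hβ z, finrank_Eig_real hα hβ z⟩,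
    fun hαβ k => ⟨?_, ?_⟩⟩
  · exact isDirectSum_Eig hα hβ
      (fun l => Complex.ofReal_inj.trans (lam_eq_lam_iff hα))
      (fun l => Complex.ofReal_inj.trans (lam_eq_lam_iff_norm_eq_sqrt hαβ))
  · have hβα : 0 < β / α := by rwa [← inv_div, inv_pos]
    exact isDirectSum_Eig hα hβ
      (fun l => Complex.ofReal_inj.trans (lam_eq_lam_iff_norm_eq_sqrt hβα))
      (fun l => Complex.ofReal_inj.trans (lam_eq_lam_iff hβ))

open FlatTorus in
theorem theorem3 (n : ℕ) (b : Module.Basis (Fin n) ℝ (Space n)) (α β : ℝ) (hα : 0 < α) (hβ : 0 < β)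
    (p : ℕ) (hp : 1 ≤ p) (hpn : p ≤ n) :
    -- the weighted unions make sense and all eigenspaces are finite-dimensional
    (∀ r : ℝ, {l : dualLattice b | ‖l.1‖ = r}.Finite) ∧
    (∀ z : ℂ, FiniteDimensional ℂ (Eig ℂ b α β p z)) ∧
    -- the spectrum
    spec b α β p =
      weightedUnion (fun l : dualLattice b => weightedSingle (lam α l) ((n - 1).choose (p - 1))) +
      weightedUnion (fun l : dualLattice b => weightedSingle (lam β l) ((n - 1).choose p)) ∧
    -- the multiplicities are the same for real-valued forms
    (∀ z : ℝ, FiniteDimensional ℝ (Eig ℝ b α β p z) ∧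
      Module.finrank ℝ (Eig ℝ b α β p z) = spec b α β p z) ∧
    -- the eigenspaces
    ∀ k : dualLattice b,
      IsDirectSum (Eig ℂ b α β p (lam α k)) (eigFamily b p ‖k.1‖ (√(α / β) * ‖k.1‖)) ∧
      IsDirectSum (Eig ℂ b α β p (lam β k)) (eigFamily b p (√(β / α) * ‖k.1‖) ‖k.1‖) := by
  obtain ⟨finite_norm_eq, finite_Eig, spec_eq, real_forms, direct_sums⟩ :=
    theorem3_general n b α β hα.ne' hβ.ne' p hp (hp.trans hpn)
  exact ⟨finite_norm_eq, finite_Eig, spec_eq, real_forms, direct_sums (div_pos hα hβ)⟩
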